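/- Let $\mathbb{K}$ be a field and $G$ an abelian group with identity $e$, with a bicharacter $\chi:G\times G\to\mathbb{K}^\times$, i.e. $\chi(gh,k)=\chi(g,k)\chi(h,k)$ and $\chi(g,hk)=\chi(g,h)\chi(g,k)$. A $(G,\chi)$-Hopf algebra is a $G$-graded unital associative $\mathbb{K}$-algebra $A=\bigoplus_{g\in G}A_g$ with linear maps $\Delta:A\to A\otimes A$, $\epsilon:A\to\mathbb{K}$, $S:A\to A$ such that: $(A,\Delta,\epsilon)$ is a graded coalgebra, i.e. a coassociative counital coalgebra with $\Delta(A_g)\subseteq\sum_{h}A_h\otimes A_{h^{-1}g}$ and $\epsilon(A_g)=0$ for $g\ne e$; $\epsilon$ is an algebra map; $\Delta$ is an algebra map $A\to(A\otimes A)^\chi$, where $(A\otimes A)^\chi$ is $A\otimes A$ with the multiplication $(a\otimes b)*(a'\otimes b')=\chi(|b|,|a'|)\,aa'\otimes bb'$ for homogeneous $a,b,a',b'$ ($|a|$ denotes the degree of $a$); and $S(A_g)\subseteq A_g$ for all $g$ and $\sum a_1S(a_2)=\epsilon(a)1_A=\sum S(a_1)a_2$ for all $a\in A$, where $\Delta(a)=\sum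 a_1\otimes a_2$. It is called a color Hopf algebra if $S$ is bijective. For a $G$-graded algebra $B$ let $B\text{-gr}$ be the abelian category of $G$-graded left $B$-modules $N=\bigoplus_g N_g$ (with $B_gN_h\subseteq N_{gh}$), with the $B$-linear maps $f:N\to N'$ satisfying $f(N_g)\subseteq N'_g$ for all $g$ as morphisms. The enveloping algebra $A^e=A\otimes A^{op}$ is graded by $A^e_g=\sum_h A_h\otimes A_{h^{-1}g}$. A graded $A$-bimodule $M=\bigoplus_g M_g$ (with $A_gM_hA_k\subseteq M_{ghk}$, and $\mathbb{K}$ acting equally from both sides) is a graded left $A^e$-module by $(a\otimes a')m=a.m.a'$; its graded Hochschild cohomology is $\mathrm{HH}^n_{\mathrm{gr}}(A,M)=\mathrm{Ext}^n_{A^e\text{-gr}}(A,M)$. Theorem. Let $A$ be a color Hopf algebra and $M$ a graded $A$-bimodule. Then for every $n\ge 0$ there is an isomorphism of $\mathbb{K}$-vector spaces $$\mathrm{HH}^n_{\mathrm{gr}}(A,M)\;\cong\;\mathrm{Ext}^n_{A\text{-gr}}(\mathbb{K},{}^{ad}M).$$ Here $\mathbb{K}$ is the graded $A$-module concentrated in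 degree $e$ on which $a\in A$ acts by multiplication by $\epsilon(a)$, and ${}^{ad}M$ is the adjoint module: the graded space $M$ with the $A$-action $a\cdot m=\sum\chi(|a_2|,|m|)\,a_1.m.S(a_2)$ for homogeneous $a\in A$, $m\in M$, where the factors $a_2$ in $\Delta(a)=\sum a_1\otimes a_2$ are taken homogeneous. -/

import Mathlib

open CategoryTheory TensorProduct DirectSum MulOpposite Coalgebra

set_option linter.unusedSectionVars false

universe w u

namespace ColorHopf

noncomputable section

/-! ### Graded spaces -/

section Glue

variable {K : Type*} {G V W X : Type*} [Field K] [DecidableEq G]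
  [AddCommGroup V] [Module K V] [AddCommGroup W] [Module K W] [AddCommGroup X] [Module K X]

/-- The linear map on a graded space `V = ⨁ V_g` that is given by `f g` on `V_g`. -/
def glue (𝒱 : G → Submodule K V) [Decomposition 𝒱] (f : G → V →ₗ[K] W) : V →ₗ[K] W :=
  (DirectSum.toModule K G W fun g => f g ∘ₗ (𝒱 g).subtype) ∘ₗ
    (decomposeLinearEquiv 𝒱).toLinearMap

theorem glue_of_mem (𝒱 : G → Submodule K V) [Decomposition 𝒱] (f : G → V →ₗ[K] W)
    {g : G} {v : V} (hv : v ∈ 𝒱 g) : glue 𝒱 f v = f g v := by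
  have : decomposeLinearEquiv 𝒱 v = DirectSum.lof K G (fun i => 𝒱 i) g ⟨v, hv⟩ := by
    exact decompose_of_mem 𝒱 hv
  simp [glue, this]

theorem graded_ext (𝒱 : G → Submodule K V) [Decomposition 𝒱] {f f' : V →ₗ[K] W}
    (h : ∀ g, ∀ v ∈ 𝒱 g, f v = f' v) : f = f' := by
  ext v
  induction v using Decomposition.inductionOn 𝒱 with
  | zero => simp
  | homogeneous m => exact h _ _ m.2
  | add m m' h1 h2 => simp [h1, h2]

/-- The projection onto the component of degree `g`. -/
def gproj (𝒱 : G → Submodule K V) [Decomposition 𝒱] (g : G) : V →ₗ[K] V :=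
  glue 𝒱 fun h => if h = g then LinearMap.id else 0

theorem gproj_same (𝒱 : G → Submodule K V) [Decomposition 𝒱] {g : G} {v : V}
    (hv : v ∈ 𝒱 g) : gproj 𝒱 g v = v := by
  simp [gproj, glue_of_mem 𝒱 _ hv]

theorem gproj_ne (𝒱 : G → Submodule K V) [Decomposition 𝒱] {g h : G} (hgh : g ≠ h) {v : V}
    (hv : v ∈ 𝒱 g) : gproj 𝒱 h v = 0 := by
  simp [gproj, glue_of_mem 𝒱 _ hv, hgh]

theorem gproj_mem (𝒱 : G → Submodule K V) [Decomposition 𝒱] (g : G) (v : V) :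
    gproj 𝒱 g v ∈ 𝒱 g := by
  induction v using Decomposition.inductionOn 𝒱 with
  | zero => simp
  | @homogeneous i m =>
    by_cases h : i = g
    · subst h; rw [gproj_same 𝒱 m.2]; exact m.2
    · rw [gproj_ne 𝒱 h m.2]; exact zero_mem _
  | add m m' h1 h2 => rw [map_add]; exact add_mem h1 h2

theorem mem_of_gproj_mem (𝒱 : G → Submodule K V) [Decomposition 𝒱] (N : Submodule K V)
    {v : V} (h : ∀ g, gproj 𝒱 g v ∈ N) : v ∈ N := by
  classical
  rw [← sum_support_decompose 𝒱 v]
  refine sum_mem fun g _ => ?_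
  convert h g using 1
  have key : ∀ v, ((decompose 𝒱 v g : 𝒱 g) : V) = gproj 𝒱 g v := by
    intro v
    induction v using Decomposition.inductionOn 𝒱 with
    | zero => simp
    | @homogeneous i m =>
      by_cases h : i = g
      · subst h; rw [gproj_same 𝒱 m.2, decompose_of_mem_same _ m.2]
      · rw [gproj_ne 𝒱 h m.2, decompose_of_mem_ne _ m.2 h]
    | add m m' h1 h2 => simp [h1, h2]
  exact key v

theorem isInternal_of_proj (𝒱 : G → Submodule K V) (p : G → V →ₗ[K] V)
    (h1 : ∀ g, ∀ v ∈ 𝒱 g, p g v = v) (h2 : ∀ g h, g ≠ h → ∀ v ∈ 𝒱 g, p h v = 0)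
    (h3 : ∀ v, v ∈ ⨆ g, 𝒱 g) : IsInternal 𝒱 := by
  rw [isInternal_submodule_iff_iSupIndep_and_iSup_eq_top]
  refine ⟨fun i => ?_, eq_top_iff.2 fun v _ => h3 v⟩
  rw [Submodule.disjoint_def]
  intro x hx hx'
  have : (⨆ j, ⨆ (_ : j ≠ i), 𝒱 j) ≤ LinearMap.ker (p i) :=
    iSup₂_le fun j hj v hv => h2 j i hj v hv
  rw [← h1 i x hx]
  exact this hx'

end Glue

/-! ### The category of graded modules -/

section GrMod

variable {K : Type*} {A : Type*} {G : Type*} [Field K] [Ring A] [Algebra K A]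
  [AddCommGroup G] [DecidableEq G]

/-- A graded left module over an algebra `A` that is graded by the family `𝒜`: an `A`-module with
a decomposition into subspaces `deg g` such that `A_g M_h ⊆ M_{g+h}`. -/
structure GrMod (𝒜 : G → Submodule K A) where
  carrier : Type w
  [addCommGroup : AddCommGroup carrier]
  [moduleBase : Module K carrier]
  [module : Module A carrier]
  [isScalarTower : IsScalarTower K A carrier]
  deg : G → Submodule K carrier
  isInternal : IsInternal deg
  smul_mem : ∀ {g h : G} {a : A} {m : carrier}, a ∈ 𝒜 g → m ∈ deg h → a • m ∈ deg (g + h)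

namespace GrMod

variable {𝒜 : G → Submodule K A}

attribute [instance] addCommGroup moduleBase module isScalarTower

instance (M : GrMod.{w} 𝒜) : Decomposition M.deg := M.isInternal.chooseDecomposition

/-- The `A`-linear maps `f` with `f(M_g) ⊆ N_g` for all `g`. -/
def homSubmodule (M N : GrMod.{w} 𝒜) : Submodule K (M.carrier →ₗ[A] N.carrier) where
  carrier := {f | ∀ g, ∀ m ∈ M.deg g, f m ∈ N.deg g}
  zero_mem' := fun g _ _ => zero_mem (N.deg g)
  add_mem' := fun hf hf' g m hm => add_mem (hf g m hm) (hf' g m hm)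
  smul_mem' := fun c _ hf g m hm => (N.deg g).smul_mem c (hf g m hm)

/-- Graded modules with the graded morphisms of degree zero. -/
instance : Category.{w} (GrMod.{w} 𝒜) where
  Hom M N := homSubmodule M N
  id M := ⟨LinearMap.id, fun _ _ hm => hm⟩
  comp f f' := ⟨f'.1 ∘ₗ f.1, fun g m hm => f'.2 g _ (f.2 g m hm)⟩

/-- The `A`-linear map underlying a morphism. -/
def Hom.lin {M N : GrMod.{w} 𝒜} (f : M ⟶ N) : M.carrier →ₗ[A] N.carrier := Subtype.val f

/-- A morphism from a linear map that preserves degrees. -/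
def mkHom {M N : GrMod.{w} 𝒜} (f : M.carrier →ₗ[A] N.carrier)
    (hf : ∀ g, ∀ m ∈ M.deg g, f m ∈ N.deg g) : M ⟶ N := Subtype.mk f hf

theorem lin_mem {M N : GrMod.{w} 𝒜} (f : M ⟶ N) {g : G} {m : M.carrier} (hm : m ∈ M.deg g) :
    Hom.lin f m ∈ N.deg g := Subtype.property f g m hm

@[ext] theorem hom_ext {M N : GrMod.{w} 𝒜} {f f' : M ⟶ N} (h : Hom.lin f = Hom.lin f') :
    f = f' := Subtype.ext h

@[simp] theorem lin_mkHom {M N : GrMod.{w} 𝒜} (f : M.carrier →ₗ[A] N.carrier)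
    (hf : ∀ g, ∀ m ∈ M.deg g, f m ∈ N.deg g) : Hom.lin (mkHom f hf) = f := rfl

@[simp] theorem lin_id (M : GrMod.{w} 𝒜) : Hom.lin (𝟙 M) = LinearMap.id := rfl

@[simp] theorem lin_comp {M N P : GrMod.{w} 𝒜} (f : M ⟶ N) (f' : N ⟶ P) :
    Hom.lin (f ≫ f') = Hom.lin f' ∘ₗ Hom.lin f := rfl

instance (M N : GrMod.{w} 𝒜) : AddCommGroup (M ⟶ N) :=
  inferInstanceAs (AddCommGroup (homSubmodule M N))

instance (M N : GrMod.{w} 𝒜) : Module K (M ⟶ N) :=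
  inferInstanceAs (Module K (homSubmodule M N))

@[simp] theorem lin_zero (M N : GrMod.{w} 𝒜) : Hom.lin (0 : M ⟶ N) = 0 := rfl

@[simp] theorem lin_add {M N : GrMod.{w} 𝒜} (f f' : M ⟶ N) :
    Hom.lin (f + f') = Hom.lin f + Hom.lin f' := rfl

@[simp] theorem lin_smul {M N : GrMod.{w} 𝒜} (c : K) (f : M ⟶ N) :
    Hom.lin (c • f) = c • Hom.lin f := rfl

instance : Preadditive (GrMod.{w} 𝒜) where
  add_comp _ _ _ f f' k := by ext; simp
  comp_add _ _ _ f k k' := by ext; simp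

instance : Linear K (GrMod.{w} 𝒜) where
  smul_comp _ _ _ c f k := by
    ext x
    simp [LinearMap.map_smul_of_tower]
  comp_smul _ _ _ f c k := by ext; simp

theorem lin_gproj {M N : GrMod.{w} 𝒜} (f : M ⟶ N) (g : G) (m : M.carrier) :
    Hom.lin f (gproj M.deg g m) = gproj N.deg g (Hom.lin f m) := by
  have : (Hom.lin f).restrictScalars K ∘ₗ gproj M.deg g
      = gproj N.deg g ∘ₗ (Hom.lin f).restrictScalars K := by
    refine graded_ext M.deg fun h m hm => ?_
    by_cases hh : h = g
    · subst hh
      simp [gproj_same M.deg hm, gproj_same N.deg (lin_mem f hm)]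
    · simp [gproj_ne M.deg hh hm, gproj_ne N.deg hh (lin_mem f hm)]
  exact LinearMap.congr_fun this m

/-- The graded submodule given by a homogeneous `A`-submodule. -/
def sub (M : GrMod.{w} 𝒜) (N : Submodule A M.carrier)
    (hN : ∀ g, ∀ m ∈ N, gproj M.deg g m ∈ N) : GrMod.{w} 𝒜 where
  carrier := N
  deg g := (M.deg g).comap (N.subtype.restrictScalars K)
  isInternal := by
    refine isInternal_of_proj _
      (fun g => (gproj M.deg g).restrict (p := N.restrictScalars K) (q := N.restrictScalars K)
        (hN g)) ?_ ?_ ?_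
    · rintro g ⟨v, hv⟩ h
      exact Subtype.ext (gproj_same M.deg h)
    · rintro g h hgh ⟨v, hv⟩ h'
      exact Subtype.ext (gproj_ne M.deg hgh h')
    · rintro ⟨v, hv⟩
      have : v ∈ (⨆ g, (M.deg g).comap (N.subtype.restrictScalars K)).map
          (N.subtype.restrictScalars K) := by
        refine mem_of_gproj_mem M.deg _ fun g => ?_
        exact ⟨⟨gproj M.deg g v, hN g v hv⟩,
          Submodule.mem_iSup_of_mem g (gproj_mem M.deg g v), rfl⟩
      obtain ⟨x, hx, rfl⟩ := this
      exact hx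
  smul_mem ha hm := M.smul_mem ha hm

/-- The inclusion of a graded submodule. -/
def subι (M : GrMod.{w} 𝒜) (N : Submodule A M.carrier)
    (hN : ∀ g, ∀ m ∈ N, gproj M.deg g m ∈ N) : M.sub N hN ⟶ M :=
  mkHom (M := M.sub N hN) N.subtype fun _ _ hm => hm

/-- The graded quotient module by a homogeneous `A`-submodule. -/
def quot (M : GrMod.{w} 𝒜) (N : Submodule A M.carrier)
    (hN : ∀ g, ∀ m ∈ N, gproj M.deg g m ∈ N) : GrMod.{w} 𝒜 where
  carrier := M.carrier ⧸ N
  deg g := (M.deg g).map (N.mkQ.restrictScalars K)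
  isInternal := by
    refine isInternal_of_proj _
      (fun g => (Submodule.mapQ (N.restrictScalars K) (N.restrictScalars K)
        (gproj M.deg g) (hN g) :)) ?_ ?_ ?_
    · rintro g _ ⟨v, hv, rfl⟩
      exact congrArg N.mkQ (gproj_same M.deg hv)
    · rintro g h hgh _ ⟨v, hv, rfl⟩
      exact (congrArg N.mkQ (gproj_ne M.deg hgh hv)).trans (map_zero _)
    · intro v
      obtain ⟨v, rfl⟩ := N.mkQ_surjective v
      have : v ∈ (⨆ g, (M.deg g).map (N.mkQ.restrictScalars K)).comap
          (N.mkQ.restrictScalars K) := by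
        refine mem_of_gproj_mem M.deg _ fun g => ?_
        exact Submodule.mem_iSup_of_mem g ⟨_, gproj_mem M.deg g v, rfl⟩
      exact this
  smul_mem := by
    rintro g h a _ ha ⟨m, hm, rfl⟩
    exact ⟨a • m, M.smul_mem ha hm, rfl⟩

/-- The projection onto a graded quotient module. -/
def quotπ (M : GrMod.{w} 𝒜) (N : Submodule A M.carrier)
    (hN : ∀ g, ∀ m ∈ N, gproj M.deg g m ∈ N) : M ⟶ M.quot N hN :=
  mkHom (N := M.quot N hN) N.mkQ fun _ m hm => ⟨m, hm, rfl⟩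

variable {M N : GrMod.{w} 𝒜} (f : M ⟶ N)

theorem ker_homogeneous (g : G) (m : M.carrier) (hm : m ∈ LinearMap.ker (Hom.lin f)) :
    gproj M.deg g m ∈ LinearMap.ker (Hom.lin f) := by
  rw [LinearMap.mem_ker] at hm ⊢
  rw [lin_gproj, hm, map_zero]

theorem range_homogeneous (g : G) (n : N.carrier) (hn : n ∈ LinearMap.range (Hom.lin f)) :
    gproj N.deg g n ∈ LinearMap.range (Hom.lin f) := by
  obtain ⟨m, rfl⟩ := hn
  exact ⟨gproj M.deg g m, lin_gproj f g m⟩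

/-- The kernel of a morphism. -/
def ker : GrMod.{w} 𝒜 := M.sub _ (ker_homogeneous f)

/-- The cokernel of a morphism. -/
def coker : GrMod.{w} 𝒜 := N.quot _ (range_homogeneous f)

/-- The inclusion of the kernel. -/
def kerι : ker f ⟶ M := M.subι _ (ker_homogeneous f)

/-- The projection onto the cokernel. -/
def cokerπ : N ⟶ coker f := N.quotπ _ (range_homogeneous f)

theorem kerι_comp : kerι f ≫ f = 0 := by
  ext x
  exact x.2

theorem comp_cokerπ : f ≫ cokerπ f = 0 := by
  ext x
  exact (Submodule.Quotient.mk_eq_zero _).2 ⟨x, rfl⟩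

theorem lin_eq_zero_of_comp {P : GrMod.{w} 𝒜} {k : P ⟶ M} (h : k ≫ f = 0) (x : P.carrier) :
    Hom.lin f (Hom.lin k x) = 0 :=
  LinearMap.congr_fun (congrArg Hom.lin h) x

/-- The kernel has the universal property. -/
def kerIsLimit : Limits.IsLimit (Limits.KernelFork.ofι (kerι f) (kerι_comp f)) :=
  Limits.KernelFork.IsLimit.ofι _ _
    (fun k hk => mkHom (N := ker f) ((Hom.lin k).codRestrict _ (lin_eq_zero_of_comp f hk))
      fun _ _ hm => lin_mem k hm)
    (fun k hk => rfl)
    (fun k hk b hb => by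
      ext x
      refine Subtype.ext ?_
      exact LinearMap.congr_fun (congrArg Hom.lin hb) x)

/-- The cokernel has the universal property. -/
def cokerIsColimit : Limits.IsColimit (Limits.CokernelCofork.ofπ (cokerπ f) (comp_cokerπ f)) :=
  Limits.CokernelCofork.IsColimit.ofπ _ _
    (fun k hk => mkHom (M := coker f) ((LinearMap.range (Hom.lin f)).liftQ (Hom.lin k) (by
        rintro _ ⟨x, rfl⟩
        exact lin_eq_zero_of_comp k hk x))
      (by
        rintro g _ ⟨m, hm, rfl⟩
        exact lin_mem k hm))
    (fun k hk => rfl)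
    (fun k hk b hb => by
      ext x
      obtain ⟨x, rfl⟩ := (LinearMap.range (Hom.lin f)).mkQ_surjective x
      exact LinearMap.congr_fun (congrArg Hom.lin hb) x)

theorem injective_of_mono [Mono f] : Function.Injective (Hom.lin f) := by
  have h : kerι f = 0 := by
    rw [← cancel_mono f, kerι_comp, Limits.zero_comp]
  rw [← LinearMap.ker_eq_bot, Submodule.eq_bot_iff]
  intro x hx
  exact LinearMap.congr_fun (congrArg Hom.lin h) (⟨x, hx⟩ : LinearMap.ker (Hom.lin f))

theorem surjective_of_epi [Epi f] : Function.Surjective (Hom.lin f) := by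
  have h : cokerπ f = 0 := by
    rw [← cancel_epi f, comp_cokerπ, Limits.comp_zero]
  intro y
  have := LinearMap.congr_fun (congrArg Hom.lin h) y
  exact (Submodule.Quotient.mk_eq_zero _).1 this

theorem mem_deg_of_injective (hf : Function.Injective (Hom.lin f)) {g : G} {m : M.carrier}
    (hm : Hom.lin f m ∈ N.deg g) : m ∈ M.deg g := by
  have : gproj M.deg g m = m := hf (by rw [lin_gproj, gproj_same N.deg hm])
  rw [← this]
  exact gproj_mem M.deg g m

/-- A monomorphism is the kernel of its cokernel. -/
theorem normalMono [Mono f] : Nonempty (NormalMono f) := ⟨{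
  Z := coker f
  g := cokerπ f
  w := comp_cokerπ f
  isLimit := Limits.KernelFork.IsLimit.ofι _ _
    (fun {P} k hk =>
      have hr : ∀ x, Hom.lin k x ∈ LinearMap.range (Hom.lin f) := fun x =>
        (Submodule.Quotient.mk_eq_zero _).1 (lin_eq_zero_of_comp _ hk x)
      mkHom ((LinearEquiv.ofInjective (Hom.lin f) (injective_of_mono f)).symm.toLinearMap ∘ₗ
        (Hom.lin k).codRestrict _ hr) (by
          intro g m hm
          apply mem_deg_of_injective f (injective_of_mono f)
          have := LinearEquiv.apply_symm_apply
            (LinearEquiv.ofInjective (Hom.lin f) (injective_of_mono f)) ⟨Hom.lin k m, hr m⟩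
          have h2 := congrArg Subtype.val this
          rw [LinearEquiv.ofInjective_apply] at h2
          exact h2.symm ▸ lin_mem k hm))
    (fun k hk => by
      ext x
      have := LinearEquiv.apply_symm_apply
        (LinearEquiv.ofInjective (Hom.lin f) (injective_of_mono f))
        ⟨Hom.lin k x, (Submodule.Quotient.mk_eq_zero _).1 (lin_eq_zero_of_comp _ hk x)⟩
      have h2 := congrArg Subtype.val this
      rw [LinearEquiv.ofInjective_apply] at h2
      exact h2)
    (fun k hk b hb => by
      rw [← cancel_mono f, hb]
      ext x
      have := LinearEquiv.apply_symm_apply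
        (LinearEquiv.ofInjective (Hom.lin f) (injective_of_mono f))
        ⟨Hom.lin k x, (Submodule.Quotient.mk_eq_zero _).1 (lin_eq_zero_of_comp _ hk x)⟩
      have h2 := congrArg Subtype.val this
      rw [LinearEquiv.ofInjective_apply] at h2
      exact h2.symm)}⟩

/-- An epimorphism is the cokernel of its kernel. -/
theorem normalEpi [Epi f] : Nonempty (NormalEpi f) := ⟨{
  W := ker f
  g := kerι f
  w := kerι_comp f
  isColimit := Limits.CokernelCofork.IsColimit.ofπ _ _
    (fun {P} k hk =>
      have hr : LinearMap.ker (Hom.lin f) ≤ LinearMap.ker (Hom.lin k) := fun x hx =>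
        lin_eq_zero_of_comp k hk (⟨x, hx⟩ : LinearMap.ker (Hom.lin f))
      mkHom ((LinearMap.ker (Hom.lin f)).liftQ (Hom.lin k) hr ∘ₗ
        ((Hom.lin f).quotKerEquivOfSurjective (surjective_of_epi f)).symm.toLinearMap) (by
          intro g n hn
          obtain ⟨m, rfl⟩ := surjective_of_epi f n
          rw [← gproj_same N.deg hn, ← lin_gproj]
          simp only [LinearMap.coe_comp, LinearEquiv.coe_coe, Function.comp_apply,
            LinearMap.quotKerEquivOfSurjective_symm_apply]
          exact lin_mem k (gproj_mem M.deg g m)))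
    (fun k hk => by
      ext x
      simp
      rfl)
    (fun k hk b hb => by
      rw [← cancel_epi f, hb]
      ext x
      simp
      rfl)}⟩

/-- The zero module. -/
def zeroObj : GrMod.{w} 𝒜 where
  carrier := PUnit
  deg _ := ⊤
  isInternal := isInternal_of_proj _ (fun _ => 0) (fun _ _ _ => rfl) (fun _ _ _ _ _ => rfl)
    (fun v => by rw [Subsingleton.elim v 0]; exact zero_mem _)
  smul_mem _ _ := trivial

instance : Limits.HasZeroObject (GrMod.{w} 𝒜) :=
  ⟨⟨zeroObj, (Limits.IsZero.iff_id_eq_zero _).2 (hom_ext (LinearMap.ext fun _ => rfl))⟩⟩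

/-- The direct sum of two graded modules. -/
def prod (M N : GrMod.{w} 𝒜) : GrMod.{w} 𝒜 where
  carrier := M.carrier × N.carrier
  deg g := (M.deg g).prod (N.deg g)
  isInternal := by
    refine isInternal_of_proj _ (fun g => (gproj M.deg g).prodMap (gproj N.deg g)) ?_ ?_ ?_
    · rintro g ⟨x, y⟩ ⟨hx, hy⟩
      exact Prod.ext (gproj_same M.deg hx) (gproj_same N.deg hy)
    · rintro g h hgh ⟨x, y⟩ ⟨hx, hy⟩
      exact Prod.ext (gproj_ne M.deg hgh hx) (gproj_ne N.deg hgh hy)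
    · rintro ⟨x, y⟩
      have h1 : x ∈ (⨆ g, (M.deg g).prod (N.deg g)).comap
          (LinearMap.inl K M.carrier N.carrier) :=
        mem_of_gproj_mem M.deg _ fun g =>
          Submodule.mem_iSup_of_mem g ⟨gproj_mem M.deg g x, zero_mem (N.deg g)⟩
      have h2 : y ∈ (⨆ g, (M.deg g).prod (N.deg g)).comap
          (LinearMap.inr K M.carrier N.carrier) :=
        mem_of_gproj_mem N.deg _ fun g =>
          Submodule.mem_iSup_of_mem g ⟨zero_mem (M.deg g), gproj_mem N.deg g y⟩
      have := add_mem (Submodule.mem_comap.1 h1) (Submodule.mem_comap.1 h2)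
      simpa using this
  smul_mem ha hm := ⟨M.smul_mem ha hm.1, N.smul_mem ha hm.2⟩

/-- The direct sum with its inclusions and projections. -/
def prodBicone (M N : GrMod.{w} 𝒜) : Limits.BinaryBicone M N where
  pt := prod M N
  fst := mkHom (M := prod M N) (LinearMap.fst A M.carrier N.carrier) fun _ _ h => h.1
  snd := mkHom (M := prod M N) (LinearMap.snd A M.carrier N.carrier) fun _ _ h => h.2
  inl := mkHom (N := prod M N) (LinearMap.inl A M.carrier N.carrier)
    fun g _ h => ⟨h, zero_mem (N.deg g)⟩
  inr := mkHom (N := prod M N) (LinearMap.inr A M.carrier N.carrier)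
    fun g _ h => ⟨zero_mem (M.deg g), h⟩
  inl_fst := rfl
  inl_snd := rfl
  inr_fst := rfl
  inr_snd := rfl

instance : Limits.HasBinaryBiproducts (GrMod.{w} 𝒜) where
  has_binary_biproduct M N := Limits.HasBinaryBiproduct.mk
    ⟨prodBicone M N, Limits.isBinaryBilimitOfTotal _ (by
      refine hom_ext (LinearMap.ext fun x => ?_)
      exact Prod.ext (add_zero x.1) (zero_add x.2))⟩

instance : Limits.HasFiniteProducts (GrMod.{w} 𝒜) :=
  hasFiniteProducts_of_has_binary_and_terminal

instance : Limits.HasKernels (GrMod.{w} 𝒜) := ⟨fun f => ⟨⟨⟨_, kerIsLimit f⟩⟩⟩⟩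

instance : Limits.HasCokernels (GrMod.{w} 𝒜) := ⟨fun f => ⟨⟨⟨_, cokerIsColimit f⟩⟩⟩⟩

instance : Abelian (GrMod.{w} 𝒜) where
  normalMonoOfMono f _ := normalMono f
  normalEpiOfEpi f _ := normalEpi f

end GrMod

end GrMod

/-! ### Color Hopf algebras -/

section Hopf

variable {K : Type*} {A : Type*} {G : Type*} [Field K] [Ring A] [Algebra K A]
  [AddCommGroup G] [DecidableEq G]

/-- A bicharacter on an (additively written) abelian group with values in the units of `K`. -/
structure Bicharacter (K G : Type*) [Field K] [AddCommGroup G] where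
  toFun : G → G → Kˣ
  map_add_left : ∀ g h k, toFun (g + h) k = toFun g k * toFun h k
  map_add_right : ∀ g h k, toFun g (h + k) = toFun g h * toFun g k

namespace Bicharacter

instance : CoeFun (Bicharacter K G) fun _ => G → G → Kˣ := ⟨toFun⟩

variable (χ : Bicharacter K G)

@[simp] theorem zero_left (k : G) : χ 0 k = 1 := by
  have := χ.map_add_left 0 0 k
  simpa using this

@[simp] theorem zero_right (k : G) : χ k 0 = 1 := by
  have := χ.map_add_right k 0 0
  simpa using this

end Bicharacter

/-- The grading of a tensor product of graded spaces: in degree `g` it is `∑ₕ Vₕ ⊗ W_{g-h}`. -/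
def tensorDeg {V W : Type*} [AddCommGroup V] [Module K V] [AddCommGroup W] [Module K W]
    (𝒱 : G → Submodule K V) (𝒲 : G → Submodule K W) (g : G) : Submodule K (V ⊗[K] W) :=
  ⨆ h : G, LinearMap.range (TensorProduct.map (𝒱 h).subtype (𝒲 (g - h)).subtype)

theorem tensorDeg_le {V W : Type*} [AddCommGroup V] [Module K V] [AddCommGroup W] [Module K W]
    {𝒱 : G → Submodule K V} {𝒲 : G → Submodule K W} {g : G} {N : Submodule K (V ⊗[K] W)}
    (H : ∀ h, ∀ v ∈ 𝒱 h, ∀ w ∈ 𝒲 (g - h), v ⊗ₜ[K] w ∈ N) : tensorDeg 𝒱 𝒲 g ≤ N := by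
  refine iSup_le fun h => ?_
  rintro _ ⟨t, rfl⟩
  induction t using TensorProduct.induction_on with
  | zero => simp
  | tmul v w => exact H h _ v.2 _ w.2
  | add x y hx hy => rw [map_add]; exact add_mem hx hy

theorem eq_on_tensorDeg {V W X : Type*} [AddCommGroup V] [Module K V] [AddCommGroup W]
    [Module K W] [AddCommGroup X] [Module K X]
    {𝒱 : G → Submodule K V} {𝒲 : G → Submodule K W} {g : G} {f f' : V ⊗[K] W →ₗ[K] X}
    (H : ∀ h, ∀ v ∈ 𝒱 h, ∀ w ∈ 𝒲 (g - h), f (v ⊗ₜ[K] w) = f' (v ⊗ₜ[K] w))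
    {t : V ⊗[K] W} (ht : t ∈ tensorDeg 𝒱 𝒲 g) : f t = f' t := by
  have : tensorDeg 𝒱 𝒲 g ≤ LinearMap.eqLocus f f' := tensorDeg_le H
  exact this ht

variable (χ : Bicharacter K G) (𝒜 : G → Submodule K A) [GradedAlgebra 𝒜]

/-- The linear map `a ↦ χ(|a|, h) a`. -/
def scale (h : G) : A →ₗ[K] A := glue 𝒜 fun g => (χ g h : K) • LinearMap.id

/-- The multiplication of the algebra `(A ⊗ A)^χ`: on homogeneous elements it is
`(a ⊗ b) * (a' ⊗ b') = χ(|b|, |a'|) aa' ⊗ bb'`. -/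
def twistedMul : A ⊗[K] A →ₗ[K] A ⊗[K] A →ₗ[K] A ⊗[K] A :=
  (TensorProduct.lift (glue (W := A →ₗ[K] A ⊗[K] A →ₗ[K] A ⊗[K] A) 𝒜 fun h =>
    ((TensorProduct.mapBilinear (.id K) A A A A).compl₂
      (LinearMap.lcomp K A (scale χ 𝒜 h) ∘ₗ (LinearMap.mul K A).flip)) ∘ₗ
        (LinearMap.mul K A).flip)).flip

variable {𝒜} in
theorem scale_of_mem {g : G} (h : G) {a : A} (ha : a ∈ 𝒜 g) :
    scale χ 𝒜 h a = (χ g h : K) • a := by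
  simp [scale, glue_of_mem 𝒜 _ ha]

variable {𝒜} in
theorem twistedMul_scale {h : G} (a b : A) {a' : A} (b' : A) (ha' : a' ∈ 𝒜 h) :
    twistedMul χ 𝒜 (a ⊗ₜ b) (a' ⊗ₜ b') = (a * a') ⊗ₜ (scale χ 𝒜 h b * b') := by
  simp [twistedMul, glue_of_mem 𝒜 _ ha']

variable {𝒜} in
theorem twistedMul_tmul {g h : G} (a : A) {b a' : A} (b' : A) (hb : b ∈ 𝒜 g) (ha' : a' ∈ 𝒜 h) :
    twistedMul χ 𝒜 (a ⊗ₜ b) (a' ⊗ₜ b') = (χ g h : K) • ((a * a') ⊗ₜ (b * b')) := by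
  rw [twistedMul_scale χ a b b' ha', scale_of_mem χ h hb, smul_mul_assoc, tmul_smul]

variable [Coalgebra K A]

/-- The conditions on a graded algebra `A = ⨁ A_g`, a coalgebra structure on `A` and a linear map
`S : A → A` to form a `(G, χ)`-Hopf algebra. -/
structure IsHopf (S : A →ₗ[K] A) : Prop where
  comul_mem : ∀ g, ∀ a ∈ 𝒜 g, comul (R := K) a ∈ tensorDeg 𝒜 𝒜 g
  counit_eq_zero : ∀ g, g ≠ 0 → ∀ a ∈ 𝒜 g, counit (R := K) a = 0
  counit_one : counit (R := K) (1 : A) = 1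
  counit_mul : ∀ a b : A, counit (R := K) (a * b) = counit (R := K) a * counit (R := K) b
  comul_one : comul (R := K) (1 : A) = 1 ⊗ₜ[K] 1
  comul_mul : ∀ a b : A, comul (R := K) (a * b) = twistedMul χ 𝒜 (comul a) (comul b)
  antipode_mem : ∀ g, ∀ a ∈ 𝒜 g, S a ∈ 𝒜 g
  mul_antipode_right : ∀ a : A,
    LinearMap.mul' K A (TensorProduct.map LinearMap.id S (comul a)) = algebraMap K A (counit a)
  mul_antipode_left : ∀ a : A,
    LinearMap.mul' K A (TensorProduct.map S LinearMap.id (comul a)) = algebraMap K A (counit a)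

/-- A color Hopf algebra is a `(G, χ)`-Hopf algebra with bijective antipode. -/
structure IsColorHopf (S : A →ₗ[K] A) : Prop extends IsHopf χ 𝒜 S where
  antipode_bijective : Function.Bijective S

variable {𝒜}

theorem scale_mem (h : G) {g : G} {a : A} (ha : a ∈ 𝒜 g) : scale χ 𝒜 h a ∈ 𝒜 g := by
  rw [scale_of_mem χ h ha]
  exact (𝒜 g).smul_mem _ ha

theorem scale_one (h : G) : scale χ 𝒜 h 1 = 1 := by
  rw [scale_of_mem χ h (SetLike.GradedOne.one_mem (A := 𝒜))]
  simp

theorem scale_mul (h : G) (a b : A) :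
    scale χ 𝒜 h (a * b) = scale χ 𝒜 h a * scale χ 𝒜 h b := by
  have : (LinearMap.mul K A).compr₂ (scale χ 𝒜 h)
      = (LinearMap.mul K A).compl₁₂ (scale χ 𝒜 h) (scale χ 𝒜 h) := by
    refine graded_ext 𝒜 fun g a ha => graded_ext 𝒜 fun k b hb => ?_
    simp [scale_of_mem χ h ha, scale_of_mem χ h hb,
      scale_of_mem χ h (SetLike.GradedMul.mul_mem ha hb), χ.map_add_left, smul_smul, mul_comm]
  exact LinearMap.congr_fun₂ this a b

theorem scale_scale (h k : G) (a : A) :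
    scale χ 𝒜 h (scale χ 𝒜 k a) = scale χ 𝒜 (h + k) a := by
  have : scale χ 𝒜 h ∘ₗ scale χ 𝒜 k = scale χ 𝒜 (h + k) := by
    refine graded_ext 𝒜 fun g a ha => ?_
    simp [scale_of_mem χ _ ha, χ.map_add_right, smul_smul, mul_comm]
  exact LinearMap.congr_fun this a

namespace IsHopf

variable {χ} {S : A →ₗ[K] A}

theorem antipode_one (hA : IsHopf χ 𝒜 S) : S 1 = 1 := by
  have := hA.mul_antipode_right 1
  simpa [hA.comul_one, hA.counit_one] using this

theorem antipode_scale (hA : IsHopf χ 𝒜 S) (h : G) (a : A) :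
    S (scale χ 𝒜 h a) = scale χ 𝒜 h (S a) := by
  have : S ∘ₗ scale χ 𝒜 h = scale χ 𝒜 h ∘ₗ S := by
    refine graded_ext 𝒜 fun g a ha => ?_
    simp [scale_of_mem χ h ha, scale_of_mem χ h (hA.antipode_mem g a ha)]
  exact LinearMap.congr_fun this a

/-- The convolution product of two linear endomorphisms. -/
def conv : (A →ₗ[K] A) →ₗ[K] (A →ₗ[K] A) →ₗ[K] (A →ₗ[K] A) :=
  LinearMap.mk₂ K (fun f f' => LinearMap.mul' K A ∘ₗ TensorProduct.map f f' ∘ₗ comul)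
    (fun _ _ _ => by ext; simp [TensorProduct.map_add_left])
    (fun _ _ _ => by ext; simp [TensorProduct.map_smul_left])
    (fun _ _ _ => by ext; simp [TensorProduct.map_add_right])
    (fun _ _ _ => by ext; simp [TensorProduct.map_smul_right])

theorem conv_apply (f f' : A →ₗ[K] A) (a : A) :
    conv f f' a = LinearMap.mul' K A (TensorProduct.map f f' (comul a)) := rfl

theorem conv_assoc (f f' f'' : A →ₗ[K] A) : conv (conv f f') f'' = conv f (conv f' f'') :=
  congrArg WithConv.ofConv
    (mul_assoc (WithConv.toConv f) (WithConv.toConv f') (WithConv.toConv f''))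

/-- The unit of the convolution product. -/
def convUnit : A →ₗ[K] A := Algebra.linearMap K A ∘ₗ counit

theorem convUnit_conv (f : A →ₗ[K] A) : conv convUnit f = f :=
  congrArg WithConv.ofConv (one_mul (WithConv.toConv f))

theorem conv_convUnit (f : A →ₗ[K] A) : conv f convUnit = f :=
  congrArg WithConv.ofConv (mul_one (WithConv.toConv f))

/-- The map `a ↦ ∑ S(x) y` where `Δ(a) * t = ∑ x ⊗ y`. -/
def phi (χ : Bicharacter K G) (𝒜 : G → Submodule K A) [GradedAlgebra 𝒜] (S : A →ₗ[K] A) :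
    A ⊗[K] A →ₗ[K] (A →ₗ[K] A) where
  toFun t := LinearMap.mul' K A ∘ₗ TensorProduct.map S LinearMap.id ∘ₗ
    (twistedMul χ 𝒜).flip t ∘ₗ comul
  map_add' _ _ := by ext; simp
  map_smul' _ _ := by ext; simp

theorem phi_apply (t : A ⊗[K] A) (a : A) : phi χ 𝒜 S t a =
    LinearMap.mul' K A (TensorProduct.map S LinearMap.id (twistedMul χ 𝒜 (comul a) t)) := rfl

theorem phi_comul (hA : IsHopf χ 𝒜 S) (b : A) :
    phi χ 𝒜 S (comul b) = counit (R := K) b • convUnit := by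
  ext a
  rw [phi_apply, ← hA.comul_mul, hA.mul_antipode_left, hA.counit_mul]
  simp [convUnit, Algebra.smul_def, mul_comm]

theorem phi_tmul {g : G} {x : A} (y : A) (hx : x ∈ 𝒜 g) : phi χ 𝒜 S (x ⊗ₜ y) =
    conv (S ∘ₗ LinearMap.mulRight K x) (LinearMap.mulRight K y ∘ₗ scale χ 𝒜 g) := by
  ext a
  rw [phi_apply, conv_apply]
  generalize comul (R := K) a = t
  induction t using TensorProduct.induction_on with
  | zero => simp
  | tmul a a' => simp [twistedMul_scale χ a a' y hx]
  | add t t' h h' => simp only [map_add, LinearMap.add_apply, h, h']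

theorem scale_conv (hA : IsHopf χ 𝒜 S) (h : G) :
    conv (scale χ 𝒜 h) (S ∘ₗ scale χ 𝒜 h) = convUnit := by
  ext a
  have H : ∀ t : A ⊗[K] A,
      LinearMap.mul' K A (TensorProduct.map (scale χ 𝒜 h) (S ∘ₗ scale χ 𝒜 h) t)
        = scale χ 𝒜 h (LinearMap.mul' K A (TensorProduct.map LinearMap.id S t)) := by
    intro t
    induction t using TensorProduct.induction_on with
    | zero => simp
    | tmul a a' => simp [scale_mul, hA.antipode_scale]
    | add t t' h h' => simp only [map_add, h, h']
  rw [conv_apply, H, hA.mul_antipode_right, Algebra.algebraMap_eq_smul_one, map_smul, scale_one]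
  simp [convUnit, Algebra.algebraMap_eq_smul_one]

/-- The antipode reverses products up to the bicharacter:
`S(ab) = χ(|a|, |b|) S(b) S(a)` for homogeneous `a` and `b`. -/
theorem antipode_mul (hA : IsHopf χ 𝒜 S) {h : G} (a : A) {b : A} (hb : b ∈ 𝒜 h) :
    S (a * b) = S b * S (scale χ 𝒜 h a) := by
  let Gm : A →ₗ[K] (A →ₗ[K] A) :=
    (LinearMap.mul K A ∘ₗ S).compl₂ (S ∘ₗ scale χ 𝒜 h)
  let Fm : A →ₗ[K] (A →ₗ[K] A) := (LinearMap.mul K A).flip.compr₂ S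
  let Psi : (A ⊗[K] A) ⊗[K] A →ₗ[K] (A →ₗ[K] A) :=
    TensorProduct.lift ((conv.compl₂ Gm) ∘ₗ phi χ 𝒜 S)
  have h1 : Psi (comul.rTensor A (comul b)) = Gm b := by
    have : Psi ∘ₗ comul.rTensor A =
        Gm ∘ₗ (TensorProduct.lid K A).toLinearMap ∘ₗ (counit (R := K) (A := A)).rTensor A := by
      refine TensorProduct.ext' fun x y => ?_
      simp [Psi, phi_comul hA, convUnit_conv]
    have := LinearMap.congr_fun this (comul b)
    simpa using this
  have h2 : Psi ((TensorProduct.assoc K A A A).symm (comul.lTensor A (comul b))) = Fm b := by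
    have : (Psi ∘ₗ (TensorProduct.assoc K A A A).symm.toLinearMap ∘ₗ comul.lTensor A) (comul b) =
        (Fm ∘ₗ (TensorProduct.rid K A).toLinearMap ∘ₗ (counit (R := K) (A := A)).lTensor A)
          (comul b) := by
      refine eq_on_tensorDeg (fun g x hx y hy => ?_) (hA.comul_mem h b hb)
      have e1 : (Psi ∘ₗ (TensorProduct.assoc K A A A).symm.toLinearMap ∘ₗ comul.lTensor A)
          (x ⊗ₜ y) = conv (S ∘ₗ LinearMap.mulRight K x)
            (counit (R := K) y • conv (scale χ 𝒜 g) (S ∘ₗ scale χ 𝒜 h)) := by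
        have e2 : ∀ t : A ⊗[K] A, Psi ((TensorProduct.assoc K A A A).symm (x ⊗ₜ t)) =
            conv (S ∘ₗ LinearMap.mulRight K x) (conv (scale χ 𝒜 g)
              (LinearMap.mulLeft K (LinearMap.mul' K A (TensorProduct.map LinearMap.id S t)) ∘ₗ
                S ∘ₗ scale χ 𝒜 h)) := by
          intro t
          induction t using TensorProduct.induction_on with
          | zero =>
            have : LinearMap.mulLeft K (0 : A) = 0 := by ext; simp
            simp [this]
          | tmul y z =>
            have e3 : Psi ((TensorProduct.assoc K A A A).symm (x ⊗ₜ (y ⊗ₜ z))) =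
                conv (S ∘ₗ LinearMap.mulRight K x)
                  (conv (LinearMap.mulRight K y ∘ₗ scale χ 𝒜 g) (Gm z)) := by
              simp [Psi, phi_tmul y hx, conv_assoc]
            rw [e3]
            congr 1
            ext a
            rw [conv_apply, conv_apply]
            generalize comul (R := K) a = s
            induction s using TensorProduct.induction_on with
            | zero => simp
            | tmul a a' => simp [Gm, mul_assoc]
            | add t t' h h' => simp only [map_add, h, h']
          | add t t' h h' =>
            have : ∀ u v : A, LinearMap.mulLeft K (u + v)
                = LinearMap.mulLeft K u + LinearMap.mulLeft K v := by
              intro u v; ext; simp [add_mul]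
            simp only [map_add, TensorProduct.tmul_add, h, h', this, LinearMap.add_comp]
        have e4 : LinearMap.mulLeft K (algebraMap K A (counit (R := K) y)) ∘ₗ
            S ∘ₗ scale χ 𝒜 h = counit (R := K) y • (S ∘ₗ scale χ 𝒜 h) := by
          ext; simp [Algebra.smul_def]
        have e5 := e2 (comul y)
        rw [hA.mul_antipode_right, e4, map_smul] at e5
        exact e5
      rw [e1]
      by_cases hg : g = h
      · subst hg
        rw [scale_conv hA, map_smul, conv_convUnit]
        ext a
        simp [Fm]
      · have : counit (R := K) y = 0 :=
          hA.counit_eq_zero (h - g) (sub_ne_zero.2 (Ne.symm hg)) y hy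
        simp [this]
    simpa using this
  have h3 : Fm b = Gm b := by
    rw [← h1, ← h2, coassoc_symm_apply]
  exact LinearMap.congr_fun h3 a

end IsHopf
end Hopf

/-! ### Graded bimodules, Hochschild cohomology and adjoint modules -/

section Bimodules

variable {K A G : Type u} [Field K] [Ring A] [Algebra K A] [AddCommGroup G] [DecidableEq G]

/-- The condition `A_g M_h A_k ⊆ M_{g+h+k}` on a bimodule `M = ⨁ M_g`. -/
def IsGradedBimodule (𝒜 : G → Submodule K A) {M : Type u} [AddCommGroup M] [Module K M]
    [Module A M] [Module Aᵐᵒᵖ M] (ℳ : G → Submodule K M) : Prop :=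
  ∀ g h k : G, ∀ a ∈ 𝒜 g, ∀ m ∈ ℳ h, ∀ b ∈ 𝒜 k, a • op b • m ∈ ℳ (g + h + k)

/-- The grading of the enveloping algebra `Aᵉ = A ⊗ Aᵒᵖ`. -/
def envDeg (𝒜 : G → Submodule K A) : G → Submodule K (A ⊗[K] Aᵐᵒᵖ) :=
  tensorDeg 𝒜 fun g => (𝒜 g).map (opLinearEquiv K).toLinearMap

variable (𝒜 : G → Submodule K A) [GradedAlgebra 𝒜]

/-- The algebra itself is a graded bimodule. -/
theorem isGradedBimodule_self : IsGradedBimodule 𝒜 𝒜 := by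
  intro g h k a ha m hm b hb
  rw [op_smul_eq_mul, smul_eq_mul, ← mul_assoc]
  exact SetLike.GradedMul.mul_mem (SetLike.GradedMul.mul_mem ha hm) hb

variable {M : Type u} [AddCommGroup M] [Module K M] [Module A M] [Module Aᵐᵒᵖ M]
  [IsScalarTower K A M] [IsScalarTower K Aᵐᵒᵖ M] [SMulCommClass A Aᵐᵒᵖ M]
  (ℳ : G → Submodule K M) [Decomposition ℳ]

/-- A graded bimodule as a graded left module over the enveloping algebra, with the action
`(a ⊗ b) m = a m b`. -/
def envModule (hM : IsGradedBimodule 𝒜 ℳ) : GrMod.{u} (envDeg 𝒜) :=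
  letI : Module (A ⊗[K] Aᵐᵒᵖ) M := TensorProduct.Algebra.module
  { carrier := M
    isScalarTower := ⟨fun c x m => LinearMap.congr_fun
      (map_smul (TensorProduct.Algebra.moduleAux (R := K) (A := A) (B := Aᵐᵒᵖ) (M := M)) c x) m⟩
    deg := ℳ
    isInternal := Decomposition.isInternal ℳ
    smul_mem := by
      intro g h x m hx hm
      have : envDeg 𝒜 g ≤ (ℳ (g + h)).comap
          ((TensorProduct.Algebra.moduleAux (R := K) (A := A) (B := Aᵐᵒᵖ) (M := M)).flip m) := by
        refine tensorDeg_le ?_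
        rintro k a ha _ ⟨b, hb, rfl⟩
        have := hM k h (g - k) a ha m hm b hb
        rw [show k + h + (g - k) = g + h by abel] at this
        exact this
      exact this hx }

theorem envModule_smul (hM : IsGradedBimodule 𝒜 ℳ) (a b : A) (m : (envModule 𝒜 ℳ hM).carrier) :
    (a ⊗ₜ[K] op b) • m = (show M from a • op b • (show M from m)) := rfl

instance {B : Type u} [Ring B] [Algebra K B] (ℬ : G → Submodule K B) :
    HasExt.{u + 1} (GrMod.{u} ℬ) := HasExt.standard _

/-- The graded Hochschild cohomology `HHⁿ(A, M) = Extⁿ(A, M)`, with `Ext` taken in the category of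
graded modules over the enveloping algebra. -/
abbrev HHgr (hM : IsGradedBimodule 𝒜 ℳ) (n : ℕ) : Type (u + 1) :=
  Abelian.Ext.{u + 1} (envModule 𝒜 𝒜 (isGradedBimodule_self 𝒜)) (envModule 𝒜 ℳ hM) n

section Hopf

variable [Coalgebra K A] {χ : Bicharacter K G} {S : A →ₗ[K] A} {𝒜}

/-- The base field, concentrated in degree `0`, with `a` acting by multiplication by `ε(a)`. -/
def trivialModule (hA : IsHopf χ 𝒜 S) : GrMod.{u} 𝒜 :=
  letI : Module A K := Module.compHom K
    { toFun := fun a : A => counit (R := K) a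
      map_one' := hA.counit_one
      map_mul' := hA.counit_mul
      map_zero' := map_zero _
      map_add' := map_add _ : A →+* K }
  { carrier := K
    isScalarTower := ⟨fun c a x => by
      change counit (R := K) (c • a) * x = c * (counit (R := K) a * x)
      rw [map_smul, smul_eq_mul, mul_assoc]⟩
    deg := fun g => if g = 0 then ⊤ else ⊥
    isInternal := isInternal_of_proj _ (fun g => if g = 0 then LinearMap.id else 0)
      (by
        intro g v hv
        by_cases hg : g = 0
        · simp [hg]
        · simpa [hg, eq_comm] using hv)
      (by
        intro g h hgh v hv
        by_cases hg : g = 0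
        · have : h ≠ 0 := fun hh => hgh (hg.trans hh.symm)
          simp [this]
        · have : v = 0 := by simpa [hg] using hv
          simp [this])
      (fun v => Submodule.mem_iSup_of_mem 0 (by simp))
    smul_mem := by
      intro g h a x ha hx
      change counit (R := K) a * x ∈ _
      by_cases hg : g = 0
      · subst hg
        by_cases hh : h = 0
        · simp [hh]
        · have : x = 0 := by simpa [hh] using hx
          simp [this]
      · simp [hA.counit_eq_zero g hg a ha] }

theorem trivialModule_smul (hA : IsHopf χ 𝒜 S) (a : A) (x : (trivialModule hA).carrier) :
    a • x = (show K from counit (R := K) a * (show K from x)) := rfl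

/-- For `t = ∑ a ⊗ b`, the endomorphism `m ↦ ∑ χ(|b|, h) a m S(b)` of a bimodule. -/
def adForm (M : Type u) [AddCommGroup M] [Module K M] [Module A M] [Module Aᵐᵒᵖ M]
    [IsScalarTower K A M] [IsScalarTower K Aᵐᵒᵖ M]
    (χ : Bicharacter K G) (𝒜 : G → Submodule K A) [GradedAlgebra 𝒜] (S : A →ₗ[K] A) (h : G) :
    A ⊗[K] A →ₗ[K] Module.End K M :=
  TensorProduct.lift ((LinearMap.mul K (Module.End K M)).compl₁₂
    (Algebra.lsmul K K M : A →ₐ[K] Module.End K M).toLinearMap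
    ((Algebra.lsmul K K M : Aᵐᵒᵖ →ₐ[K] Module.End K M).toLinearMap ∘ₗ
      (opLinearEquiv K).toLinearMap ∘ₗ S ∘ₗ scale χ 𝒜 h))

theorem adForm_tmul (h : G) (a b : A) (m : M) :
    adForm M χ 𝒜 S h (a ⊗ₜ b) m = a • op (S (scale χ 𝒜 h b)) • m := rfl

/-- The adjoint action: `a m = ∑ χ(|a₂|, |m|) a₁ m S(a₂)` for homogeneous `m`. -/
def adAct (χ : Bicharacter K G) (𝒜 : G → Submodule K A) [GradedAlgebra 𝒜] (S : A →ₗ[K] A)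
    (a : A) : Module.End K M :=
  glue ℳ fun h => adForm M χ 𝒜 S h (comul a)

theorem adAct_of_mem {h : G} (a : A) {m : M} (hm : m ∈ ℳ h) :
    adAct ℳ χ 𝒜 S a m = adForm M χ 𝒜 S h (comul a) m := glue_of_mem ℳ _ hm

theorem adForm_mem (hA : IsHopf χ 𝒜 S) (hM : IsGradedBimodule 𝒜 ℳ) {g h : G} {t : A ⊗[K] A}
    (ht : t ∈ tensorDeg 𝒜 𝒜 g) {m : M} (hm : m ∈ ℳ h) :
    adForm M χ 𝒜 S h t m ∈ ℳ (g + h) := by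
  have : tensorDeg 𝒜 𝒜 g ≤ (ℳ (g + h)).comap ((adForm M χ 𝒜 S h).flip m) := by
    refine tensorDeg_le fun k a ha b hb => ?_
    have := hM k h (g - k) a ha m hm _ (hA.antipode_mem _ _ (scale_mem χ h hb))
    rw [show k + h + (g - k) = g + h by abel] at this
    exact this
  exact this ht

theorem adForm_twistedMul (hA : IsHopf χ 𝒜 S) (h k : G) (t : A ⊗[K] A) {u : A ⊗[K] A}
    (hu : u ∈ tensorDeg 𝒜 𝒜 k) (m : M) :
    adForm M χ 𝒜 S h (twistedMul χ 𝒜 t u) m =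
      adForm M χ 𝒜 S (k + h) t (adForm M χ 𝒜 S h u m) := by
  induction t using TensorProduct.induction_on with
  | zero => simp
  | tmul a b =>
    refine eq_on_tensorDeg (f := (adForm M χ 𝒜 S h).flip m ∘ₗ twistedMul χ 𝒜 (a ⊗ₜ b))
      (f' := adForm M χ 𝒜 S (k + h) (a ⊗ₜ b) ∘ₗ (adForm M χ 𝒜 S h).flip m)
      (fun l a' ha' b' hb' => ?_) hu
    have e := hA.antipode_mul (scale χ 𝒜 (h + l) b) (scale_mem χ h hb')
    rw [scale_scale, show k - l + (h + l) = k + h by abel] at e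
    simp only [LinearMap.comp_apply, LinearMap.flip_apply, twistedMul_scale χ a b b' ha',
      adForm_tmul, scale_mul, scale_scale, e, op_mul, mul_smul]
    rw [smul_comm a' (op (S (scale χ 𝒜 (k + h) b)))]
  | add t t' h1 h2 => simp only [map_add, LinearMap.add_apply, h1, h2]

/-- The adjoint action as a representation of `A` on the space `M`. -/
def adRep (hA : IsHopf χ 𝒜 S) (hM : IsGradedBimodule 𝒜 ℳ) : A →ₐ[K] Module.End K M :=
  AlgHom.ofLinearMap
    { toFun := adAct ℳ χ 𝒜 S
      map_add' := fun a b => graded_ext ℳ fun h m hm => by simp [adAct_of_mem ℳ _ hm]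
      map_smul' := fun c a => graded_ext ℳ fun h m hm => by simp [adAct_of_mem ℳ _ hm] }
    (graded_ext ℳ fun h m hm => by
      simp [adAct_of_mem ℳ _ hm, hA.comul_one, adForm_tmul, scale_one, hA.antipode_one])
    (fun a b => graded_ext ℳ fun h m hm => by
      -- both sides are linear in `b`, so that `b` may be taken homogeneous
      induction b using Decomposition.inductionOn 𝒜 with
      | zero => simp [adAct_of_mem ℳ _ hm]
      | @homogeneous k b =>
        have hb := hA.comul_mem k b b.2
        change adAct ℳ χ 𝒜 S (a * b) m = adAct ℳ χ 𝒜 S a (adAct ℳ χ 𝒜 S b m)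
        rw [adAct_of_mem ℳ _ hm, adAct_of_mem ℳ _ hm,
          adAct_of_mem ℳ _ (adForm_mem ℳ hA hM hb hm), hA.comul_mul,
          adForm_twistedMul hA h k _ hb]
      | add b b' h1 h2 =>
        simp only [mul_add, map_add, LinearMap.add_apply, h1, h2])

/-- The graded module given by a representation of `A` on a graded space `M`. -/
def GrMod.ofRep {M : Type u} [AddCommGroup M] [Module K M] (ℳ : G → Submodule K M)
    [Decomposition ℳ] (ρ : A →ₐ[K] Module.End K M)
    (hρ : ∀ g h, ∀ a ∈ 𝒜 g, ∀ m ∈ ℳ h, ρ a m ∈ ℳ (g + h)) : GrMod.{u} 𝒜 :=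
  letI : Module A M := Module.compHom M ρ.toRingHom
  { carrier := M
    isScalarTower := ⟨fun c a m => LinearMap.congr_fun (map_smul ρ c a) m⟩
    deg := ℳ
    isInternal := Decomposition.isInternal ℳ
    smul_mem := fun ha hm => hρ _ _ _ ha _ hm }

/-- The adjoint module of a graded bimodule `M`: the graded space `M` with the adjoint action. -/
def adModule (hA : IsHopf χ 𝒜 S) (hM : IsGradedBimodule 𝒜 ℳ) : GrMod.{u} 𝒜 :=
  GrMod.ofRep ℳ (adRep ℳ hA hM) fun g h a ha m hm => by
    change adAct ℳ χ 𝒜 S a m ∈ _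
    rw [adAct_of_mem ℳ a hm]
    exact adForm_mem ℳ hA hM (hA.comul_mem g a ha) hm

theorem adModule_smul (hA : IsHopf χ 𝒜 S) (hM : IsGradedBimodule 𝒜 ℳ) (a : A)
    (m : (adModule ℳ hA hM).carrier) :
    a • m = (show M from adAct ℳ χ 𝒜 S a (show M from m)) := rfl

end Hopf
end Bimodules

end

end ColorHopf

open ColorHopf

/-!
The adjoint module `M ↦ ᵃᵈM` is an exact functor from graded bimodules to graded `A`-modules, as it
does not change the underlying graded space. It has a left adjoint, which sends a graded module `N`
to the bimodule `N ⊗ A` with right multiplication on the second factor and the left action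
`a (n ⊗ c) = ∑ χ(|a₂|, |n|) a₁ n ⊗ a₂ c` (`ind`, `indAdjunction`). A bimodule map `φ` corresponds
to `n ↦ φ(n ⊗ 1)` and a map `f` to the adjoint module corresponds to `n ⊗ b ↦ f(n) b`; that these
are linear is an antipode computation (`lift_lTensor_comul` with `indForm_tmul_antipode` and
`op_smul_adForm`). Tensoring over a field is exact, so the left adjoint is exact, and it sends the
trivial module to the bimodule `A` (`indTrivialHom`).

For an adjunction `F ⊣ H` of exact functors, `Extⁿ(F X, Y) ≅ Extⁿ(X, H Y)`
(`nonempty_ext_linearEquiv`). The map is induced by `F` and the counit, and is bijective by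
dimension shifting along a projective presentation of `X`, since `F` preserves projective objects.
Graded modules have enough projective objects, namely the free ones on homogeneous generators
(`GrMod.free`).
-/

namespace ColorHopf

noncomputable section

/-! ### `Ext` and adjoint functors -/

section ExtAdjunction

open Limits Abelian

variable {C : Type*} [Category* C] [Abelian C] {D : Type*} [Category* D] [Abelian D]

/-- A left adjoint functor of abelian categories that preserves monomorphisms is exact. -/
theorem preservesFiniteLimits_of_adjunction {F : C ⥤ D} {H : D ⥤ C} [F.Additive] (adj : F ⊣ H)
    [F.PreservesMonomorphisms] : PreservesFiniteLimits F := by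
  have : PreservesFiniteColimits F := by
    have := adj.leftAdjoint_preservesColimits
    exact PreservesColimits.preservesFiniteColimits F
  have H : ∀ S : ShortComplex C, S.ShortExact → (S.map F).ShortExact := fun S hS => by
    have := hS.mono_f
    have : Mono (S.map F).f := inferInstanceAs (Mono (F.map S.f))
    have R := (F.preservesFiniteColimits_tfae.out 3 0 :
      PreservesFiniteColimits F ↔ ∀ S : ShortComplex C, S.ShortExact →
        (S.map F).Exact ∧ Epi (F.map S.g)).1 inferInstance S hS
    exact { exact := R.1, epi_g := R.2 }
  exact ((F.exact_tfae.out 0 3 : (∀ S : ShortComplex C, S.ShortExact → (S.map F).ShortExact) ↔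
    PreservesFiniteLimits F ∧ PreservesFiniteColimits F).1 H).1

variable [HasExt.{w} C] [HasExt.{u} D] (R : Type*) [Ring R] [Linear R C] [Linear R D]
  (F : C ⥤ D) [F.Additive] [F.Linear R] [PreservesFiniteLimits F] [PreservesFiniteColimits F]

/-- An exact functor `F` and a morphism `ε : F Z ⟶ Y` induce maps `Extⁿ(X, Z) → Extⁿ(F X, Y)`. -/
def extTranspose {Z : C} {Y : D} (ε : F.obj Z ⟶ Y) (X : C) (n : ℕ) :
    Ext.{w} X Z n →ₗ[R] Ext.{u} (F.obj X) Y n where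
  toFun x := (x.mapExactFunctor F).comp (Ext.mk₀ ε) (add_zero n)
  map_add' x y := by simp
  map_smul' r x := by simp

theorem extTranspose_apply {Z : C} {Y : D} (ε : F.obj Z ⟶ Y) (X : C) (n : ℕ) (x : Ext X Z n) :
    extTranspose R F ε X n x = (x.mapExactFunctor F).comp (Ext.mk₀ ε) (add_zero n) := rfl

attribute [local instance] Ext.subsingleton_of_projective in
/-- If `F` preserves projective objects and `ε : F Z ⟶ Y` is universal among the morphisms
`F X ⟶ Y`, then `Extⁿ(X, Z) → Extⁿ(F X, Y)` is bijective. Both sides vanish for projective `X` and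
positive `n`, so a presentation of `X` by a projective object reduces degree `n + 1` to `n`. -/
theorem extTranspose_bijective [EnoughProjectives C] [F.PreservesProjectiveObjects] {Z : C} {Y : D}
    (ε : F.obj Z ⟶ Y)
    (h : ∀ X : C, Function.Bijective fun f : X ⟶ Z => F.map f ≫ ε) (X : C) (n : ℕ) :
    Function.Bijective (extTranspose.{w, u} R F ε X n) := by
  induction n generalizing X with
  | zero =>
    have e : ⇑(extTranspose.{w, u} R F ε X 0) =
        Ext.homEquiv₀.symm ∘ (fun f : X ⟶ Z => F.map f ≫ ε) ∘ Ext.homEquiv₀ := by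
      funext x
      obtain ⟨y, rfl⟩ := (Ext.mk₀_bijective X Z).2 x
      simp [extTranspose_apply, Ext.mapExactFunctor_mk₀, Ext.homEquiv₀]
    rw [e]
    exact Ext.homEquiv₀.symm.bijective.comp ((h X).comp Ext.homEquiv₀.bijective)
  | succ n hn =>
    let P : ProjectivePresentation X := Classical.arbitrary _
    let S := ShortComplex.mk _ _ (kernel.condition P.f)
    have : Projective (S.map F).X₂ := Functor.PreservesProjectiveObjects.projective_obj P.projective
    have hS : S.ShortExact := { exact := ShortComplex.exact_kernel P.f }
    exact AddMonoidHom.bijective_of_surjective_of_bijective_of_right_exact _ _ _ _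
      (extTranspose.{w, u} R F ε S.X₂ n).toAddMonoidHom
      (extTranspose.{w, u} R F ε S.X₁ n).toAddMonoidHom
      (extTranspose.{w, u} R F ε S.X₃ (n + 1)).toAddMonoidHom
      (by ext x; simp [extTranspose_apply, Ext.mapExactFunctor_comp, Ext.mapExactFunctor_mk₀]; rfl)
      (by
        ext x
        simp [extTranspose_apply, Ext.mapExactFunctor_comp, Ext.mapExactFunctor_extClass]
        exact (Ext.comp_assoc _ _ _ (add_comm 1 n) (add_zero n) (by lia)).symm)
      ((ShortComplex.ab_exact_iff_function_exact _).1
        (Ext.contravariant_sequence_exact₁' hS Z n (n + 1) (add_comm 1 n)))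
      ((ShortComplex.ab_exact_iff_function_exact _).1
        (Ext.contravariant_sequence_exact₁' (hS.map F) Y n (n + 1) (add_comm 1 n)))
      (hn _).surjective (hn _)
      (fun x₃ ↦ Ext.contravariant_sequence_exact₃ hS _ x₃ (by subsingleton) (add_comm 1 n))
      (fun y₃ ↦ Ext.contravariant_sequence_exact₃ (hS.map F) _ y₃ (by subsingleton) (add_comm 1 n))

/-- Precomposition with an isomorphism, as a linear equivalence of `Ext` spaces. -/
def extPrecompIso {X X' : C} (e : X ≅ X') (Y : C) (n : ℕ) :
    Ext.{w} X' Y n ≃ₗ[R] Ext.{w} X Y n where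
  toFun x := (Ext.mk₀ e.hom).comp x (zero_add n)
  invFun x := (Ext.mk₀ e.inv).comp x (zero_add n)
  map_add' x y := by simp
  map_smul' r x := by simp
  left_inv x := by simp
  right_inv x := by simp

/-- For an adjunction `F ⊣ H` of exact functors, `Extⁿ(F X, Y)` is isomorphic to
`Extⁿ(X, H Y)`. -/
theorem nonempty_ext_linearEquiv {F : C ⥤ D} [F.Additive] [F.Linear R] {H : D ⥤ C} (adj : F ⊣ H)
    [F.PreservesMonomorphisms] [H.PreservesEpimorphisms] [EnoughProjectives C] {X Z : C} {X' Y : D}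
    (e : F.obj X ≅ X') (e' : Z ≅ H.obj Y) (n : ℕ) :
    Nonempty (Ext.{u} X' Y n ≃ₗ[R] Ext.{w} X Z n) := by
  have := preservesFiniteLimits_of_adjunction adj
  have : PreservesFiniteColimits F := by
    have := adj.leftAdjoint_preservesColimits
    exact PreservesColimits.preservesFiniteColimits F
  have : F.PreservesProjectiveObjects :=
    F.preservesProjectiveObjects_of_adjunction_of_preservesEpimorphisms adj
  have h : ∀ X : C, Function.Bijective fun f : X ⟶ Z =>
      F.map f ≫ (adj.homEquiv Z Y).symm e'.hom := by
    intro X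
    have : (fun f : X ⟶ Z => F.map f ≫ (adj.homEquiv Z Y).symm e'.hom) =
        (adj.homEquiv X Y).symm ∘ fun f => f ≫ e'.hom := by
      funext f
      exact (adj.homEquiv_naturality_left_symm f e'.hom).symm
    rw [this]
    exact (adj.homEquiv X Y).symm.bijective.comp e'.homToEquiv.bijective
  exact ⟨extPrecompIso R e Y n ≪≫ₗ
    (LinearEquiv.ofBijective _ (extTranspose_bijective.{w, u} R F _ h X n)).symm⟩

end ExtAdjunction


/-! ### Projective graded modules -/

section Projectives

variable {K : Type*} {A : Type*} {G : Type*} [Field K] [Ring A] [Algebra K A]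
  [AddCommGroup G] [DecidableEq G]

namespace GrMod

section

variable {𝒜 : G → Submodule K A} {M N : GrMod.{w} 𝒜}

theorem mono_of_injective (f : M ⟶ N) (hf : Function.Injective (Hom.lin f)) : Mono f where
  right_cancellation k k' h := by
    ext x
    exact hf (LinearMap.congr_fun (congrArg Hom.lin h) x)

theorem epi_of_surjective (f : M ⟶ N) (hf : Function.Surjective (Hom.lin f)) : Epi f where
  left_cancellation k k' h := by
    ext x
    obtain ⟨x, rfl⟩ := hf x
    exact LinearMap.congr_fun (congrArg Hom.lin h) x

theorem isIso_of_bijective (f : M ⟶ N) (hf : Function.Bijective (Hom.lin f)) : IsIso f := by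
  have := mono_of_injective f hf.1
  have := epi_of_surjective f hf.2
  exact isIso_of_mono_of_epi f

end

/-- The grading of the space `⨁ᵢ A` that puts the `i`-th generator in degree `d i`. -/
def freeDeg (𝒜 : G → Submodule K A) {ι : Type*} (d : ι → G) (g : G) : Submodule K (ι →₀ A) :=
  ⨅ i, (𝒜 (g - d i)).comap (Finsupp.lapply i)

theorem mem_freeDeg {𝒜 : G → Submodule K A} {ι : Type*} {d : ι → G} {g : G} {v : ι →₀ A} :
    v ∈ freeDeg 𝒜 d g ↔ ∀ i, v i ∈ 𝒜 (g - d i) := by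
  simp [freeDeg]

theorem single_mem_freeDeg {𝒜 : G → Submodule K A} {ι : Type*} (d : ι → G) (i : ι) {g : G} {a : A}
    (ha : a ∈ 𝒜 g) : Finsupp.single i a ∈ freeDeg 𝒜 d (g + d i) := by
  rw [mem_freeDeg]
  intro j
  by_cases hj : i = j
  · subst hj
    simpa using ha
  · simp [hj]

/-- The free graded module with a generator of degree `d i` for each index `i`. -/
def free (𝒜 : G → Submodule K A) [GradedAlgebra 𝒜] {ι : Type*} (d : ι → G) : GrMod 𝒜 where
  carrier := ι →₀ A
  deg := freeDeg 𝒜 d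
  isInternal := by
    refine isInternal_of_proj _ (fun g => Finsupp.lsum K fun i =>
      Finsupp.lsingle i ∘ₗ gproj 𝒜 (g - d i)) ?_ ?_ ?_
    · intro g v hv
      rw [mem_freeDeg] at hv
      rw [Finsupp.lsum_apply]
      conv_rhs => rw [← v.sum_single]
      exact Finsupp.sum_congr fun i _ => by simp [gproj_same 𝒜 (hv i)]
    · intro g h hgh v hv
      rw [mem_freeDeg] at hv
      rw [Finsupp.lsum_apply]
      refine Finset.sum_eq_zero fun i _ => ?_
      have : g - d i ≠ h - d i := fun hi => hgh (sub_left_injective hi)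
      simp [gproj_ne 𝒜 this (hv i)]
    · intro v
      induction v using Finsupp.induction_linear with
      | zero => exact zero_mem _
      | add v w hv hw => exact add_mem hv hw
      | single i a =>
        exact mem_of_gproj_mem 𝒜 (Submodule.comap (Finsupp.lsingle i) (⨆ g, freeDeg 𝒜 d g))
          fun g => Submodule.mem_iSup_of_mem (g + d i)
            (single_mem_freeDeg d i (gproj_mem 𝒜 g a))
  smul_mem := by
    intro g h a m ha hm
    rw [mem_freeDeg] at hm ⊢
    intro i
    rw [add_sub_assoc]
    exact SetLike.GradedMul.mul_mem ha (hm i)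

variable {𝒜 : G → Submodule K A} [GradedAlgebra 𝒜]

/-- The `i`-th generator of a free graded module. -/
def free.gen {ι : Type*} (d : ι → G) (i : ι) : (free 𝒜 d).carrier :=
  (Finsupp.single i (1 : A) : ι →₀ A)

theorem free.gen_mem {ι : Type*} (d : ι → G) (i : ι) :
    free.gen d i ∈ (free 𝒜 d).deg (d i) := by
  have := single_mem_freeDeg d i (SetLike.GradedOne.one_mem (A := 𝒜))
  rwa [zero_add] at this

/-- The morphism from a free graded module that sends the generators to given homogeneous
elements. -/
def freeHom {ι : Type*} {d : ι → G} (N : GrMod 𝒜) (n : ∀ i, N.deg (d i)) : free 𝒜 d ⟶ N :=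
  mkHom (M := free 𝒜 d) (Finsupp.linearCombination A fun i => (n i : N.carrier)) (by
    intro g v hv
    have hv := mem_freeDeg.1 hv
    refine sum_mem fun i _ => ?_
    have := N.smul_mem (hv i) (n i).2
    rwa [sub_add_cancel] at this)

theorem freeHom_gen {ι : Type*} {d : ι → G} (N : GrMod 𝒜) (n : ∀ i, N.deg (d i)) (i : ι) :
    Hom.lin (freeHom N n) (free.gen d i) = n i :=
  (Finsupp.linearCombination_single A 1 i).trans (one_smul A _)

theorem free_hom_ext {ι : Type*} {d : ι → G} {N : GrMod 𝒜} {f f' : free 𝒜 d ⟶ N}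
    (h : ∀ i, Hom.lin f (free.gen d i) = Hom.lin f' (free.gen d i)) : f = f' :=
  hom_ext (Finsupp.lhom_ext' fun i => LinearMap.ext_ring (h i))

theorem exists_preimage_mem {M N : GrMod.{w} 𝒜} (f : M ⟶ N) [Epi f] {g : G} {n : N.carrier}
    (hn : n ∈ N.deg g) : ∃ m ∈ M.deg g, Hom.lin f m = n := by
  obtain ⟨m, rfl⟩ := surjective_of_epi f n
  exact ⟨_, gproj_mem M.deg g m, by rw [lin_gproj, gproj_same N.deg hn]⟩

end GrMod

end Projectives

section EnoughProjectives

variable {K A G : Type u} [Field K] [Ring A] [Algebra K A] [AddCommGroup G] [DecidableEq G]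
  {𝒜 : G → Submodule K A} [GradedAlgebra 𝒜]

namespace GrMod

instance {ι : Type u} (d : ι → G) : Projective (free 𝒜 d) where
  factors {E X} f e _ := by
    choose n hn hn' using fun i => exists_preimage_mem e (lin_mem f (free.gen_mem d i))
    refine ⟨freeHom E fun i => ⟨n i, hn i⟩, free_hom_ext fun i => ?_⟩
    rw [lin_comp, LinearMap.comp_apply, freeHom_gen]
    exact hn' i

/-- The free graded module on all homogeneous elements of `N` maps onto `N`. -/
instance : EnoughProjectives (GrMod.{u} 𝒜) where
  presentation N := by
    let f : free 𝒜 (fun i : Σ g, N.deg g => i.1) ⟶ N := freeHom N fun i => i.2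
    refine ⟨{ p := _, f := f, epi := epi_of_surjective f ?_ }⟩
    rw [← LinearMap.range_eq_top, eq_top_iff]
    intro n _
    refine mem_of_gproj_mem N.deg ((LinearMap.range (Hom.lin f)).restrictScalars K) fun g => ?_
    exact ⟨_, freeHom_gen N (fun i : Σ g, N.deg g => i.2) ⟨g, _, gproj_mem N.deg g n⟩⟩

end GrMod

end EnoughProjectives


/-! ### The grading of a tensor product -/

section TensorGrading

variable {K G V W X : Type*} [Field K] [AddCommGroup G] [DecidableEq G]
  [AddCommGroup V] [Module K V] [AddCommGroup W] [Module K W] [AddCommGroup X] [Module K X]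

theorem tmul_mem_tensorDeg {𝒱 : G → Submodule K V} {𝒲 : G → Submodule K W} {g h : G} {v : V} {w : W}
    (hv : v ∈ 𝒱 g) (hw : w ∈ 𝒲 h) : v ⊗ₜ[K] w ∈ tensorDeg 𝒱 𝒲 (g + h) :=
  Submodule.mem_iSup_of_mem g
    ⟨⟨v, hv⟩ ⊗ₜ ⟨w, by rwa [add_sub_cancel_left]⟩, by simp⟩

theorem tensor_graded_ext (𝒱 : G → Submodule K V) [Decomposition 𝒱]
    {f f' : V ⊗[K] W →ₗ[K] X} (h : ∀ g, ∀ v ∈ 𝒱 g, ∀ w, f (v ⊗ₜ w) = f' (v ⊗ₜ w)) : f = f' :=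
  TensorProduct.ext (graded_ext 𝒱 fun g v hv => LinearMap.ext fun w => h g v hv w)

theorem isInternal_tensorDeg (𝒱 : G → Submodule K V) (𝒲 : G → Submodule K W) [Decomposition 𝒱]
    [Decomposition 𝒲] : IsInternal (tensorDeg 𝒱 𝒲) := by
  have key : ∀ g h, ∀ v ∈ 𝒱 h, ∀ w, TensorProduct.lift (glue 𝒱 fun h =>
      (TensorProduct.mk K V W).compl₂ (gproj 𝒲 (g - h))) (v ⊗ₜ w) = v ⊗ₜ gproj 𝒲 (g - h) w := by
    intro g h v hv w
    simp [glue_of_mem 𝒱 _ hv]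
  refine isInternal_of_proj _ (fun g => TensorProduct.lift (glue 𝒱 fun h =>
    (TensorProduct.mk K V W).compl₂ (gproj 𝒲 (g - h)))) ?_ ?_ ?_
  · intro g t ht
    refine eq_on_tensorDeg (f' := LinearMap.id) (fun h v hv w hw => ?_) ht
    rw [key g h v hv, gproj_same 𝒲 hw, LinearMap.id_apply]
  · intro g g' hg t ht
    refine eq_on_tensorDeg (f' := 0) (fun h v hv w hw => ?_) ht
    rw [key g' h v hv, gproj_ne 𝒲 (fun e => hg (sub_left_injective e)) hw, tmul_zero,
      LinearMap.zero_apply]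
  · intro t
    induction t using TensorProduct.induction_on with
    | zero => exact zero_mem _
    | add x y hx hy => exact add_mem hx hy
    | tmul v w =>
      refine mem_of_gproj_mem 𝒱 ((⨆ g, tensorDeg 𝒱 𝒲 g).comap ((TensorProduct.mk K V W).flip w))
        fun g => ?_
      refine mem_of_gproj_mem 𝒲 ((⨆ g, tensorDeg 𝒱 𝒲 g).comap
        (TensorProduct.mk K V W (gproj 𝒱 g v))) fun h => ?_
      exact Submodule.mem_iSup_of_mem (g + h)
        (tmul_mem_tensorDeg (gproj_mem 𝒱 g v) (gproj_mem 𝒲 h w))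

end TensorGrading

/-! ### The induced bimodule -/

section Induced

variable {K A G : Type u} [Field K] [Ring A] [Algebra K A] [AddCommGroup G] [DecidableEq G]
  (χ : Bicharacter K G) {𝒜 : G → Submodule K A} [GradedAlgebra 𝒜] (N : GrMod.{u} 𝒜)

/-- The map `n ⊗ c ↦ χ(|b|, |n|) n ⊗ bc`. -/
def braidMul (b : A) : Module.End K (N.carrier ⊗[K] A) :=
  TensorProduct.lift (glue N.deg fun h =>
    (TensorProduct.mk K N.carrier A).compl₂ (LinearMap.mulLeft K (scale χ 𝒜 h b)))

variable {N} in
theorem braidMul_tmul {h : G} {n : N.carrier} (hn : n ∈ N.deg h) (b c : A) :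
    braidMul χ N b (n ⊗ₜ c) = n ⊗ₜ (scale χ 𝒜 h b * c) := by
  simp [braidMul, glue_of_mem N.deg _ hn]

/-- The action of the algebra `(A ⊗ A)^χ` on `N ⊗ A`, given by
`(a ⊗ b) (n ⊗ c) = χ(|b|, |n|) an ⊗ bc`. -/
def indForm : A ⊗[K] A →ₗ[K] Module.End K (N.carrier ⊗[K] A) :=
  TensorProduct.lift (LinearMap.mk₂ K
    (fun a b => Algebra.lsmul K K (N.carrier ⊗[K] A) a ∘ₗ braidMul χ N b)
    (fun a a' b => by simp [LinearMap.add_comp])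
    (fun c a b => by simp [LinearMap.smul_comp])
    (fun a b b' => tensor_graded_ext N.deg fun h n hn c => by
      simp [braidMul_tmul χ hn, add_mul, tmul_add])
    (fun r a b => tensor_graded_ext N.deg fun h n hn c => by
      simp [braidMul_tmul χ hn, smul_comm a r]))

variable {N} in
theorem indForm_tmul {h : G} {n : N.carrier} (hn : n ∈ N.deg h) (a b c : A) :
    indForm χ N (a ⊗ₜ b) (n ⊗ₜ c) = (a • n) ⊗ₜ (scale χ 𝒜 h b * c) := by
  simp [indForm, braidMul_tmul χ hn, smul_tmul']

variable [Coalgebra K A]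

theorem indForm_twistedMul (t u : A ⊗[K] A) :
    indForm χ N (twistedMul χ 𝒜 t u) = indForm χ N t * indForm χ N u := by
  have : (twistedMul χ 𝒜).compr₂ (indForm χ N) =
      (LinearMap.mul K (Module.End K (N.carrier ⊗[K] A))).compl₁₂ (indForm χ N) (indForm χ N) := by
    refine TensorProduct.ext' fun a b => ?_
    refine tensor_graded_ext 𝒜 fun l a' ha' b' => ?_
    refine tensor_graded_ext N.deg fun h n hn c => ?_
    simp only [LinearMap.compr₂_apply, LinearMap.compl₁₂_apply, LinearMap.mul_apply',
      Module.End.mul_apply, twistedMul_scale χ a b b' ha', indForm_tmul χ hn,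
      indForm_tmul χ (N.smul_mem ha' hn), mul_smul]
    rw [scale_mul, scale_scale, add_comm h l, mul_assoc]
  exact LinearMap.congr_fun₂ this t u

/-- Right multiplication on the second factor of `N ⊗ A`. -/
def indRight : Aᵐᵒᵖ →ₐ[K] Module.End K (N.carrier ⊗[K] A) :=
  AlgHom.ofLinearMap
    (LinearMap.lTensorHom N.carrier ∘ₗ (LinearMap.mul K A).flip ∘ₗ
      (opLinearEquiv K).symm.toLinearMap)
    (by ext; simp)
    (fun b b' => by ext; simp [mul_assoc])

theorem indRight_tmul (b : A) (n : N.carrier) (c : A) :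
    indRight N (op b) (n ⊗ₜ c) = n ⊗ₜ (c * b) := rfl

variable {χ} {S : A →ₗ[K] A} (hA : IsHopf χ 𝒜 S)

/-- The left action `a (n ⊗ c) = ∑ χ(|a₂|, |n|) a₁ n ⊗ a₂ c` of `A` on `N ⊗ A`. -/
def indLeft : A →ₐ[K] Module.End K (N.carrier ⊗[K] A) :=
  AlgHom.ofLinearMap (indForm χ N ∘ₗ comul)
    (tensor_graded_ext N.deg fun h n hn c => by
      simp [hA.comul_one, indForm_tmul χ hn, scale_one])
    (fun a b => by simp [hA.comul_mul, indForm_twistedMul])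

theorem commute_indForm_indRight (t : A ⊗[K] A) (b : Aᵐᵒᵖ) :
    Commute (indForm χ N t) (indRight N b) := by
  induction t using TensorProduct.induction_on with
  | zero => rw [map_zero]; exact Commute.zero_left _
  | add t u ht hu => rw [map_add]; exact ht.add_left hu
  | tmul x y =>
    refine tensor_graded_ext N.deg fun h n hn c => ?_
    obtain ⟨b, rfl⟩ := op_surjective b
    simp only [Module.End.mul_apply, indRight_tmul, indForm_tmul χ hn, mul_assoc]

/-- The action of the enveloping algebra on `N ⊗ A`. -/
def indRep : A ⊗[K] Aᵐᵒᵖ →ₐ[K] Module.End K (N.carrier ⊗[K] A) :=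
  Algebra.TensorProduct.lift (indLeft N hA) (indRight N)
    fun a b => commute_indForm_indRight N (comul a) b

theorem indRep_left (a : A) (x : N.carrier ⊗[K] A) :
    indRep N hA (a ⊗ₜ 1) x = indForm χ N (comul a) x := by
  change indForm χ N (comul a) (indRight N 1 x) = _
  rw [map_one, Module.End.one_apply]

theorem indRep_right (b : Aᵐᵒᵖ) (x : N.carrier ⊗[K] A) :
    indRep N hA (1 ⊗ₜ b) x = indRight N b x := by
  change indLeft N hA 1 (indRight N b x) = _
  rw [map_one, Module.End.one_apply]

theorem indForm_mem {g h : G} {t : A ⊗[K] A} (ht : t ∈ tensorDeg 𝒜 𝒜 g) {x : N.carrier ⊗[K] A}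
    (hx : x ∈ tensorDeg N.deg 𝒜 h) : indForm χ N t x ∈ tensorDeg N.deg 𝒜 (g + h) := by
  refine (show tensorDeg 𝒜 𝒜 g ≤ (tensorDeg N.deg 𝒜 (g + h)).comap ((indForm χ N).flip x) from
    tensorDeg_le fun k a ha b hb => ?_) ht
  refine (show tensorDeg N.deg 𝒜 h ≤ (tensorDeg N.deg 𝒜 (g + h)).comap (indForm χ N (a ⊗ₜ b)) from
    tensorDeg_le fun l n hn c hc => ?_) hx
  rw [Submodule.mem_comap, indForm_tmul χ hn]
  have := tmul_mem_tensorDeg (N.smul_mem ha hn)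
    (SetLike.GradedMul.mul_mem (scale_mem χ l hb) hc)
  rwa [show k + l + (g - k + (h - l)) = g + h by abel] at this

theorem indRight_mem {g h : G} {b : A} (hb : b ∈ 𝒜 g) {x : N.carrier ⊗[K] A}
    (hx : x ∈ tensorDeg N.deg 𝒜 h) : indRight N (op b) x ∈ tensorDeg N.deg 𝒜 (g + h) := by
  refine (show tensorDeg N.deg 𝒜 h ≤ (tensorDeg N.deg 𝒜 (g + h)).comap (indRight N (op b)) from
    tensorDeg_le fun l n hn c hc => ?_) hx
  rw [Submodule.mem_comap, indRight_tmul]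
  have := tmul_mem_tensorDeg hn (SetLike.GradedMul.mul_mem hc hb)
  rwa [show l + (h - l + g) = g + h by abel] at this

/-- The graded bimodule `N ⊗ A` induced by a graded module `N`: the algebra `A` acts on the right
by multiplication on the second factor, and on the left by
`a (n ⊗ c) = ∑ χ(|a₂|, |n|) a₁ n ⊗ a₂ c`. -/
def ind : GrMod.{u} (envDeg 𝒜) :=
  letI : Module (A ⊗[K] Aᵐᵒᵖ) (N.carrier ⊗[K] A) :=
    Module.compHom (N.carrier ⊗[K] A) (indRep N hA).toRingHom
  { carrier := N.carrier ⊗[K] A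
    isScalarTower := ⟨fun c x m => LinearMap.congr_fun (map_smul (indRep N hA) c x) m⟩
    deg := tensorDeg N.deg 𝒜
    isInternal := isInternal_tensorDeg N.deg 𝒜
    smul_mem := by
      intro g h x m hx hm
      refine (show envDeg 𝒜 g ≤ (tensorDeg N.deg 𝒜 (g + h)).comap
        ((indRep N hA).toLinearMap.flip m) from tensorDeg_le ?_) hx
      rintro k a ha _ ⟨b, hb, rfl⟩
      have := indForm_mem (χ := χ) N (hA.comul_mem k a ha) (indRight_mem N hb hm)
      rwa [show k + (g - k + h) = g + h by abel] at this }

theorem ind_smul (x : A ⊗[K] Aᵐᵒᵖ) (m : (ind N hA).carrier) :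
    x • m = (show N.carrier ⊗[K] A from indRep N hA x (show N.carrier ⊗[K] A from m)) := rfl

/-- A linear map between modules over the enveloping algebra is linear over it if it is so for the
left and the right action of `A`. -/
def envLinearMap {V W : Type*} [AddCommGroup V] [Module K V] [Module (A ⊗[K] Aᵐᵒᵖ) V]
    [AddCommGroup W] [Module K W] [Module (A ⊗[K] Aᵐᵒᵖ) W] (f : V →ₗ[K] W)
    (hl : ∀ (a : A) v, f ((a ⊗ₜ[K] (1 : Aᵐᵒᵖ)) • v) = (a ⊗ₜ[K] (1 : Aᵐᵒᵖ)) • f v)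
    (hr : ∀ (b : A) v, f (((1 : A) ⊗ₜ[K] op b) • v) = ((1 : A) ⊗ₜ[K] op b) • f v) :
    V →ₗ[A ⊗[K] Aᵐᵒᵖ] W where
  toFun := f
  map_add' := map_add f
  map_smul' x v := by
    induction x using TensorProduct.induction_on with
    | zero =>
      exact (congrArg f (zero_smul (A ⊗[K] Aᵐᵒᵖ) v)).trans
        ((map_zero f).trans (zero_smul (A ⊗[K] Aᵐᵒᵖ) (f v)).symm)
    | add x y hx hy => simp only [add_smul, map_add, hx, hy]
    | tmul a b =>
      obtain ⟨b, rfl⟩ := op_surjective b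
      have : a ⊗ₜ[K] op b = (a ⊗ₜ[K] (1 : Aᵐᵒᵖ)) * ((1 : A) ⊗ₜ[K] op b) := by simp
      rw [this, mul_smul, hl, hr, RingHom.id_apply, mul_smul]

variable {N} {N' : GrMod.{u} 𝒜}

theorem rTensor_indForm (f : N ⟶ N') (t : A ⊗[K] A) (x : N.carrier ⊗[K] A) :
    ((GrMod.Hom.lin f).restrictScalars K).rTensor A (indForm χ N t x) =
      indForm χ N' t (((GrMod.Hom.lin f).restrictScalars K).rTensor A x) := by
  induction t using TensorProduct.induction_on with
  | zero => simp
  | add t u ht hu => simp only [map_add, LinearMap.add_apply, ht, hu]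
  | tmul a b =>
    refine LinearMap.congr_fun (f := ((GrMod.Hom.lin f).restrictScalars K).rTensor A ∘ₗ
      indForm χ N (a ⊗ₜ b)) (g := indForm χ N' (a ⊗ₜ b) ∘ₗ
      ((GrMod.Hom.lin f).restrictScalars K).rTensor A)
      (tensor_graded_ext N.deg fun h n hn c => ?_) x
    simp [indForm_tmul χ hn, indForm_tmul χ (GrMod.lin_mem f hn)]

/-- The morphism `f ⊗ id` of induced bimodules. -/
def indMap (f : N ⟶ N') : ind N hA ⟶ ind N' hA :=
  GrMod.mkHom (M := ind N hA) (N := ind N' hA)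
    (envLinearMap (V := (ind N hA).carrier) (W := (ind N' hA).carrier)
      (((GrMod.Hom.lin f).restrictScalars K).rTensor A)
      (fun a v => by
        rw [ind_smul, ind_smul]
        change ((GrMod.Hom.lin f).restrictScalars K).rTensor A (indRep N hA _ _) = indRep N' hA _ _
        rw [indRep_left, indRep_left]
        exact rTensor_indForm f _ _)
      (fun b v => by
        rw [ind_smul, ind_smul]
        change ((GrMod.Hom.lin f).restrictScalars K).rTensor A (indRep N hA _ _) = indRep N' hA _ _
        rw [indRep_right, indRep_right]
        refine LinearMap.congr_fun (f := ((GrMod.Hom.lin f).restrictScalars K).rTensor A ∘ₗ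
          indRight N (op b)) (g := indRight N' (op b) ∘ₗ
          ((GrMod.Hom.lin f).restrictScalars K).rTensor A) (TensorProduct.ext' fun n c => ?_) v
        simp [indRight_tmul]))
    (fun g v hv => by
      refine (show tensorDeg N.deg 𝒜 g ≤ (tensorDeg N'.deg 𝒜 g).comap
        (((GrMod.Hom.lin f).restrictScalars K).rTensor A) from
          tensorDeg_le fun h n hn c hc => ?_) hv
      have := tmul_mem_tensorDeg (GrMod.lin_mem f hn) hc
      rwa [add_sub_cancel] at this)

/-- The induction functor from graded modules to graded bimodules. -/
def indFunctor : GrMod.{u} 𝒜 ⥤ GrMod.{u} (envDeg 𝒜) where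
  obj N := ind N hA
  map f := indMap hA f
  map_id N := by
    refine GrMod.hom_ext (LinearMap.ext fun x => ?_)
    exact LinearMap.congr_fun (LinearMap.rTensor_id A N.carrier) x
  map_comp f f' := by
    refine GrMod.hom_ext (LinearMap.ext fun x => ?_)
    exact LinearMap.congr_fun (LinearMap.rTensor_comp A ((GrMod.Hom.lin f').restrictScalars K)
      ((GrMod.Hom.lin f).restrictScalars K)) x

instance : (indFunctor hA).Additive where
  map_add {_ _ f f'} := by
    refine GrMod.hom_ext (LinearMap.ext fun x => ?_)
    exact LinearMap.congr_fun (LinearMap.rTensor_add A ((GrMod.Hom.lin f).restrictScalars K)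
      ((GrMod.Hom.lin f').restrictScalars K)) x

instance : (indFunctor hA).Linear K where
  map_smul f r := by
    refine GrMod.hom_ext (LinearMap.ext fun x => ?_)
    exact LinearMap.congr_fun (LinearMap.rTensor_smul A r
      ((GrMod.Hom.lin f).restrictScalars K)) x

/-- Tensor products over a field preserve injectivity. -/
instance : (indFunctor hA).PreservesMonomorphisms where
  preserves f _ := GrMod.mono_of_injective _
    (Module.Flat.rTensor_preserves_injective_linearMap (M := A)
      ((GrMod.Hom.lin f).restrictScalars K) (GrMod.injective_of_mono f))

end Induced


/-! ### The adjoint module as a functor on graded bimodules -/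

section EnvelopingModules

variable {K A G : Type u} [Field K] [Ring A] [Algebra K A] [AddCommGroup G] [DecidableEq G]
  {𝒜 : G → Submodule K A}

namespace GrMod

/-- The left action of `A` on a module over the enveloping algebra. -/
instance envLeft (Y : GrMod.{u} (envDeg 𝒜)) : Module A Y.carrier :=
  Module.compHom Y.carrier (Algebra.TensorProduct.includeLeft : A →ₐ[K] A ⊗[K] Aᵐᵒᵖ).toRingHom

/-- The right action of `A` on a module over the enveloping algebra. -/
instance envRight (Y : GrMod.{u} (envDeg 𝒜)) : Module Aᵐᵒᵖ Y.carrier :=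
  Module.compHom Y.carrier (Algebra.TensorProduct.includeRight : Aᵐᵒᵖ →ₐ[K] A ⊗[K] Aᵐᵒᵖ).toRingHom

variable (Y : GrMod.{u} (envDeg 𝒜))

theorem envLeft_smul (a : A) (y : Y.carrier) : a • y = (a ⊗ₜ[K] (1 : Aᵐᵒᵖ)) • y := rfl

theorem envRight_smul (b : Aᵐᵒᵖ) (y : Y.carrier) : b • y = ((1 : A) ⊗ₜ[K] b) • y := rfl

instance : IsScalarTower K A Y.carrier where
  smul_assoc c a y := by
    rw [envLeft_smul, envLeft_smul, ← smul_tmul', smul_assoc]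

instance : IsScalarTower K Aᵐᵒᵖ Y.carrier where
  smul_assoc c a y := by
    rw [envRight_smul, envRight_smul, tmul_smul, smul_assoc]

instance : SMulCommClass A Aᵐᵒᵖ Y.carrier where
  smul_comm a b y := by
    simp only [envRight_smul, envLeft_smul, ← mul_smul, Algebra.TensorProduct.tmul_mul_tmul,
      one_mul, mul_one]

variable [GradedAlgebra 𝒜]

theorem isGradedBimodule_deg : IsGradedBimodule 𝒜 Y.deg := by
  intro g h k a ha m hm b hb
  have h1 : a ⊗ₜ[K] op b ∈ envDeg 𝒜 (g + k) := tmul_mem_tensorDeg ha ⟨b, hb, rfl⟩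
  have := Y.smul_mem h1 hm
  rw [show g + k + h = g + h + k by abel] at this
  convert this using 1
  rw [envRight_smul, envLeft_smul, ← mul_smul, Algebra.TensorProduct.tmul_mul_tmul, one_mul,
    mul_one]

end GrMod

end EnvelopingModules

section Adjoint

variable {K A G : Type u} [Field K] [Ring A] [Algebra K A] [AddCommGroup G] [DecidableEq G]
  {χ : Bicharacter K G} {𝒜 : G → Submodule K A} [GradedAlgebra 𝒜] [Coalgebra K A] {S : A →ₗ[K] A}
  (hA : IsHopf χ 𝒜 S)

section Functoriality

variable {M : Type u} [AddCommGroup M] [Module K M] [Module A M] [Module Aᵐᵒᵖ M]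
  [IsScalarTower K A M] [IsScalarTower K Aᵐᵒᵖ M] [SMulCommClass A Aᵐᵒᵖ M]
  (ℳ : G → Submodule K M) [Decomposition ℳ] (hM : IsGradedBimodule 𝒜 ℳ)
  {M' : Type u} [AddCommGroup M'] [Module K M'] [Module A M'] [Module Aᵐᵒᵖ M']
  [IsScalarTower K A M'] [IsScalarTower K Aᵐᵒᵖ M'] [SMulCommClass A Aᵐᵒᵖ M']
  (ℳ' : G → Submodule K M') [Decomposition ℳ'] (hM' : IsGradedBimodule 𝒜 ℳ')

/-- A degree preserving map of bimodules is a morphism of the adjoint modules. -/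
def adHom (f : M →ₗ[K] M') (hf : ∀ g, ∀ m ∈ ℳ g, f m ∈ ℳ' g)
    (hl : ∀ (a : A) m, f (a • m) = a • f m) (hr : ∀ (b : Aᵐᵒᵖ) m, f (b • m) = b • f m) :
    adModule ℳ hA hM ⟶ adModule ℳ' hA hM' :=
  GrMod.mkHom (M := adModule ℳ hA hM) (N := adModule ℳ' hA hM')
    { toFun := f
      map_add' := map_add f
      map_smul' := fun a m => by
        refine LinearMap.congr_fun (f := f ∘ₗ adAct ℳ χ 𝒜 S a) (g := adAct ℳ' χ 𝒜 S a ∘ₗ f)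
          (graded_ext ℳ fun h m hm => ?_) m
        rw [LinearMap.comp_apply, LinearMap.comp_apply, adAct_of_mem ℳ a hm,
          adAct_of_mem ℳ' a (hf h m hm)]
        generalize comul (R := K) a = t
        induction t using TensorProduct.induction_on with
        | zero => simp
        | add t u ht hu => simp only [map_add, LinearMap.add_apply, ht, hu]
        | tmul x y => rw [adForm_tmul, adForm_tmul, hl, hr] }
    hf

end Functoriality

/-- The functor that sends a graded bimodule to its adjoint module. -/
def adFunctor : GrMod.{u} (envDeg 𝒜) ⥤ GrMod.{u} 𝒜 where
  obj Y := adModule Y.deg hA Y.isGradedBimodule_deg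
  map {Y Y'} f := adHom hA Y.deg _ Y'.deg _ ((GrMod.Hom.lin f).restrictScalars K)
    (fun _ _ hm => GrMod.lin_mem f hm) (fun a m => (GrMod.Hom.lin f).map_smul (a ⊗ₜ 1) m)
    (fun b m => (GrMod.Hom.lin f).map_smul (1 ⊗ₜ b) m)

instance : (adFunctor hA).PreservesEpimorphisms where
  preserves f _ := GrMod.epi_of_surjective _ (GrMod.surjective_of_epi f)

/-! ### The adjunction -/

/-- If `T(∑ z₁ ⊗ z₂) = ε(z) 1`, then `∑ B(a₁, T(a₂ ⊗ a₃)) = B(a, 1)`. -/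
theorem lift_lTensor_comul {X : Type*} [AddCommGroup X] [Module K X] (T : A ⊗[K] A →ₗ[K] A)
    (hT : ∀ z : A, T (comul z) = algebraMap K A (counit z)) (B : A →ₗ[K] A →ₗ[K] X) (a : A) :
    TensorProduct.lift B
      (T.lTensor A (TensorProduct.assoc K A A A (comul.rTensor A (comul a)))) = B a 1 := by
  have hT' : T ∘ₗ comul = Algebra.linearMap K A ∘ₗ counit := LinearMap.ext hT
  rw [coassoc_apply, ← LinearMap.comp_apply (T.lTensor A), ← LinearMap.lTensor_comp, hT', LinearMap.lTensor_comp,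
    LinearMap.comp_apply, lTensor_counit_comul]
  simp

/-- For `s = ∑ a₁ ⊗ a₂` and `z = a₃`, this is the term
`∑ χ(|a₂|, |n|) χ(|a₃|, |n|) a₁ n ⊗ a₂ S(a₃)`, written so that `lift_lTensor_comul` applies. -/
theorem indForm_tmul_antipode (hA : IsHopf χ 𝒜 S) {N : GrMod.{u} 𝒜} {h : G} {n : N.carrier} (hn : n ∈ N.deg h)
    (s : A ⊗[K] A) (z : A) :
    indForm χ N s (n ⊗ₜ S (scale χ 𝒜 h z)) =
      TensorProduct.lift ((TensorProduct.mk K N.carrier A).compl₁₂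
          ((Algebra.lsmul K K N.carrier : A →ₐ[K] _).toLinearMap.flip n) (scale χ 𝒜 h))
        ((LinearMap.mul' K A ∘ₗ TensorProduct.map LinearMap.id S).lTensor A
          (TensorProduct.assoc K A A A (s ⊗ₜ z))) := by
  induction s using TensorProduct.induction_on with
  | zero => simp
  | add s t hs ht => simp only [map_add, LinearMap.add_apply, hs, ht, TensorProduct.add_tmul]
  | tmul x y => simp [indForm_tmul χ hn, scale_mul, hA.antipode_scale]

/-- For `s = ∑ a₁ ⊗ a₂` and `z = a₃`, this is the term
`∑ χ(|a₂|, h) χ(|a₃|, h) a₁ m S(a₂) a₃`, written so that `lift_lTensor_comul` applies. -/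
theorem op_smul_adForm (hA : IsHopf χ 𝒜 S) {M : Type u} [AddCommGroup M] [Module K M] [Module A M] [Module Aᵐᵒᵖ M]
    [IsScalarTower K A M] [IsScalarTower K Aᵐᵒᵖ M] [SMulCommClass A Aᵐᵒᵖ M]
    (h : G) (m : M) (s : A ⊗[K] A) (z : A) :
    op (scale χ 𝒜 h z) • adForm M χ 𝒜 S h s m =
      TensorProduct.lift ((Algebra.lsmul K K M : A →ₐ[K] _).toLinearMap.flip.compl₁₂
          (((Algebra.lsmul K K M : Aᵐᵒᵖ →ₐ[K] _).toLinearMap.flip m) ∘ₗ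
            (opLinearEquiv K).toLinearMap ∘ₗ scale χ 𝒜 h) LinearMap.id).flip
        ((LinearMap.mul' K A ∘ₗ TensorProduct.map S LinearMap.id).lTensor A
          (TensorProduct.assoc K A A A (s ⊗ₜ z))) := by
  induction s using TensorProduct.induction_on with
  | zero => simp
  | add s t hs ht =>
    simp only [map_add, LinearMap.add_apply, hs, ht, TensorProduct.add_tmul, smul_add]
  | tmul x y =>
    rw [adForm_tmul, ← smul_comm x, ← mul_smul, ← op_mul, hA.antipode_scale, ← scale_mul]
    simp

variable (N : GrMod.{u} 𝒜) (Y : GrMod.{u} (envDeg 𝒜))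

/-- The restriction of a bimodule morphism `N ⊗ A ⟶ Y` to `N`. It is linear for the adjoint
action since `∑ a₁ (n ⊗ S(a₂)) = an ⊗ 1` up to the values of the bicharacter. -/
def indRestrict (φ : ind N hA ⟶ Y) : N ⟶ (adFunctor hA).obj Y :=
  GrMod.mkHom (N := (adFunctor hA).obj Y)
    { toFun := fun n => GrMod.Hom.lin φ (n ⊗ₜ[K] (1 : A) : N.carrier ⊗[K] A)
      map_add' := fun n n' => by
        rw [TensorProduct.add_tmul]
        exact map_add (GrMod.Hom.lin φ) _ _
      map_smul' := fun a n => by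
        let L : N.carrier ⊗[K] A →ₗ[K] Y.carrier := (GrMod.Hom.lin φ).restrictScalars K
        refine LinearMap.congr_fun (f := L ∘ₗ (TensorProduct.mk K N.carrier A).flip 1 ∘ₗ
            Algebra.lsmul K K N.carrier a)
          (g := adAct Y.deg χ 𝒜 S a ∘ₗ L ∘ₗ (TensorProduct.mk K N.carrier A).flip 1)
          (graded_ext N.deg fun h n hn => ?_) n
        have hl : ∀ (x : A) v, L (indForm χ N (comul x) v) = x • L v := fun x v => by
          rw [← indRep_left N hA]
          exact (GrMod.Hom.lin φ).map_smul (x ⊗ₜ[K] (1 : Aᵐᵒᵖ)) v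
        have hr : ∀ (b : A) v, L (indRight N (op b) v) = op b • L v := fun b v => by
          rw [← indRep_right N hA]
          exact (GrMod.Hom.lin φ).map_smul ((1 : A) ⊗ₜ[K] op b) v
        have hn' : L (n ⊗ₜ 1) ∈ Y.deg h := by
          have := tmul_mem_tensorDeg hn (SetLike.GradedOne.one_mem (A := 𝒜))
          rw [add_zero] at this
          exact GrMod.lin_mem φ this
        -- For `t = Δ(a)` the right side is a triple coproduct `L(∑ a₁ n ⊗ a₂ S(a₃))`, where the
        -- values of the bicharacter combine to `χ(|a₂ S(a₃)|, h)`, which is `1` on scalars.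
        have key : ∀ t : A ⊗[K] A, adForm Y.carrier χ 𝒜 S h t (L (n ⊗ₜ 1)) =
            L (TensorProduct.lift ((TensorProduct.mk K N.carrier A).compl₁₂
              ((Algebra.lsmul K K N.carrier : A →ₐ[K] _).toLinearMap.flip n) (scale χ 𝒜 h))
              ((LinearMap.mul' K A ∘ₗ TensorProduct.map LinearMap.id S).lTensor A
                (TensorProduct.assoc K A A A (comul.rTensor A t)))) := by
          intro t
          induction t using TensorProduct.induction_on with
          | zero => simp
          | add s t hs ht => simp only [map_add, LinearMap.add_apply, hs, ht]
          | tmul x z =>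
            rw [adForm_tmul, ← hr, ← hl, indRight_tmul, one_mul, indForm_tmul_antipode hA hn,
              LinearMap.rTensor_tmul]
        change L ((a • n) ⊗ₜ 1) = adAct Y.deg χ 𝒜 S a (L (n ⊗ₜ 1))
        rw [adAct_of_mem Y.deg a hn', key, lift_lTensor_comul _ hA.mul_antipode_right]
        simp [scale_one] }
    (fun g n hn => by
      have := tmul_mem_tensorDeg hn (SetLike.GradedOne.one_mem (A := 𝒜))
      rw [add_zero] at this
      exact GrMod.lin_mem φ this)

/-- The bimodule morphism `n ⊗ b ↦ f(n) b` that extends a morphism `f` to the adjoint module. -/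
def indExtend (f : N ⟶ (adFunctor hA).obj Y) : ind N hA ⟶ Y :=
  let L : N.carrier →ₗ[K] Y.carrier := (GrMod.Hom.lin f).restrictScalars K
  let Φ : N.carrier ⊗[K] A →ₗ[K] Y.carrier :=
    TensorProduct.lift ((Algebra.lsmul K K Y.carrier : Aᵐᵒᵖ →ₐ[K] _).toLinearMap.flip.compl₁₂ L
      (opLinearEquiv K).toLinearMap)
  have hΦ : ∀ n b, Φ (n ⊗ₜ b) = op b • L n := fun n b => rfl
  GrMod.mkHom (M := ind N hA) (envLinearMap (V := (ind N hA).carrier) (W := Y.carrier) Φ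
    (fun a v => by
      rw [ind_smul]
      change Φ (indRep N hA _ _) = a • Φ _
      rw [indRep_left]
      refine LinearMap.congr_fun (f := Φ ∘ₗ indForm χ N (comul a))
        (g := Algebra.lsmul K K Y.carrier a ∘ₗ Φ) (tensor_graded_ext N.deg fun h n hn b => ?_) v
      -- For `t = Δ(a)` the right side is `∑ a₁ f(n) S(a₂) a₃ b` with the values of the
      -- bicharacter, which collapses to `a f(n) b`.
      have key : ∀ t : A ⊗[K] A, Φ (indForm χ N t (n ⊗ₜ b)) =
          op b • TensorProduct.lift
            ((Algebra.lsmul K K Y.carrier : A →ₐ[K] _).toLinearMap.flip.compl₁₂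
              (((Algebra.lsmul K K Y.carrier : Aᵐᵒᵖ →ₐ[K] _).toLinearMap.flip (L n)) ∘ₗ
                (opLinearEquiv K).toLinearMap ∘ₗ scale χ 𝒜 h) LinearMap.id).flip
            ((LinearMap.mul' K A ∘ₗ TensorProduct.map S LinearMap.id).lTensor A
              (TensorProduct.assoc K A A A (comul.rTensor A t))) := by
        intro t
        induction t using TensorProduct.induction_on with
        | zero => simp
        | add s t hs ht => simp only [map_add, LinearMap.add_apply, hs, ht, smul_add]
        | tmul x z =>
          have hx : L (x • n) = adForm Y.carrier χ 𝒜 S h (comul x) (L n) :=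
            ((GrMod.Hom.lin f).map_smul x n).trans (adAct_of_mem Y.deg x (GrMod.lin_mem f hn))
          rw [indForm_tmul χ hn, hΦ, op_mul, mul_smul, hx, op_smul_adForm hA,
            LinearMap.rTensor_tmul]
      rw [LinearMap.comp_apply, key, lift_lTensor_comul _ hA.mul_antipode_left]
      simp [scale_one, hΦ, smul_comm a])
    (fun b v => by
      rw [ind_smul]
      change Φ (indRep N hA _ _) = op b • Φ _
      rw [indRep_right]
      refine LinearMap.congr_fun (f := Φ ∘ₗ indRight N (op b))
        (g := Algebra.lsmul K K Y.carrier (op b) ∘ₗ Φ) (TensorProduct.ext' fun n c => ?_) v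
      simp [indRight_tmul, hΦ, mul_smul]))
    (fun g v hv => by
      refine (show tensorDeg N.deg 𝒜 g ≤ (Y.deg g).comap Φ from
        tensorDeg_le fun h n hn c hc => ?_) hv
      have := Y.isGradedBimodule_deg 0 h (g - h) 1 (SetLike.GradedOne.one_mem (A := 𝒜)) (L n)
        (GrMod.lin_mem f hn) c hc
      rwa [one_smul, zero_add, add_sub_cancel] at this)

theorem indExtend_restrict (φ : ind N hA ⟶ Y) : indExtend hA N Y (indRestrict hA N Y φ) = φ := by
  have : ((GrMod.Hom.lin (indExtend hA N Y (indRestrict hA N Y φ))).restrictScalars K :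
      N.carrier ⊗[K] A →ₗ[K] Y.carrier) = (GrMod.Hom.lin φ).restrictScalars K := by
    refine TensorProduct.ext' fun n b => ?_
    refine ((GrMod.Hom.lin φ).map_smul ((1 : A) ⊗ₜ[K] op b)
      (n ⊗ₜ[K] (1 : A) : N.carrier ⊗[K] A)).symm.trans ?_
    change GrMod.Hom.lin φ (indRep N hA _ (n ⊗ₜ[K] (1 : A))) = GrMod.Hom.lin φ (n ⊗ₜ[K] b)
    rw [indRep_right, indRight_tmul, one_mul]
  exact GrMod.hom_ext (LinearMap.ext fun x => LinearMap.congr_fun this x)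

theorem indRestrict_extend (f : N ⟶ (adFunctor hA).obj Y) :
    indRestrict hA N Y (indExtend hA N Y f) = f := by
  refine GrMod.hom_ext (LinearMap.ext fun n => ?_)
  exact one_smul Aᵐᵒᵖ (show Y.carrier from GrMod.Hom.lin f n)

/-- Induction is left adjoint to the adjoint module functor. -/
def indAdjunction : indFunctor hA ⊣ adFunctor hA :=
  Adjunction.mkOfHomEquiv
    { homEquiv := fun N Y =>
        { toFun := indRestrict hA N Y
          invFun := indExtend hA N Y
          left_inv := indExtend_restrict hA N Y
          right_inv := indRestrict_extend hA N Y }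
      homEquiv_naturality_left_symm := fun {N' N Y} f g => by
        have : ((GrMod.Hom.lin (indExtend hA N' Y (f ≫ g))).restrictScalars K :
            N'.carrier ⊗[K] A →ₗ[K] Y.carrier) =
            (GrMod.Hom.lin (indMap hA f ≫ indExtend hA N Y g)).restrictScalars K :=
          TensorProduct.ext' fun n b => rfl
        exact GrMod.hom_ext (LinearMap.ext fun x => LinearMap.congr_fun this x)
      homEquiv_naturality_right := fun f g => rfl }

end Adjoint


/-! ### The values of the functors -/

section Values

variable {K A G : Type u} [Field K] [Ring A] [Algebra K A] [AddCommGroup G] [DecidableEq G]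
  {χ : Bicharacter K G} {𝒜 : G → Submodule K A} [GradedAlgebra 𝒜] [Coalgebra K A] {S : A →ₗ[K] A}
  (hA : IsHopf χ 𝒜 S)

theorem mem_trivialModule_deg {g : G} {x : (trivialModule hA).carrier} (hg : g ≠ 0)
    (hx : x ∈ (trivialModule hA).deg g) : x = 0 := by
  have hx : (show K from x) ∈ (if g = 0 then ⊤ else ⊥ : Submodule K K) := hx
  rw [if_neg hg] at hx
  exact hx

theorem scale_zero (a : A) : scale χ 𝒜 0 a = a := by
  have : scale χ 𝒜 0 = LinearMap.id := graded_ext 𝒜 fun g a ha => by simp [scale_of_mem χ 0 ha]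
  exact LinearMap.congr_fun this a

/-- The space `K ⊗ A` of the bimodule induced by the trivial module, identified with `A`. -/
def indTrivialEquiv : (trivialModule hA).carrier ⊗[K] A ≃ₗ[K] A := TensorProduct.lid K A

theorem indTrivialEquiv_tmul (x : (trivialModule hA).carrier) (c : A) :
    indTrivialEquiv hA (x ⊗ₜ c) = (show K from x) • c := rfl

theorem indTrivialEquiv_indForm (t : A ⊗[K] A) (v : (trivialModule hA).carrier ⊗[K] A) :
    indTrivialEquiv hA (indForm χ (trivialModule hA) t v) =
      TensorProduct.lid K A (counit.rTensor A t) * indTrivialEquiv hA v := by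
  induction t using TensorProduct.induction_on with
  | zero => simp
  | add t u ht hu => simp only [map_add, LinearMap.add_apply, ht, hu, add_mul]
  | tmul a b =>
    refine LinearMap.congr_fun
      (f := (indTrivialEquiv hA).toLinearMap ∘ₗ indForm χ (trivialModule hA) (a ⊗ₜ b))
      (g := LinearMap.mulLeft K (TensorProduct.lid K A (counit.rTensor A (a ⊗ₜ b))) ∘ₗ
        (indTrivialEquiv hA).toLinearMap)
      (tensor_graded_ext (trivialModule hA).deg fun h x hx c => ?_) v
    -- `K` is concentrated in degree `0`, where the bicharacter takes the value `1`.
    by_cases hh : h = 0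
    · subst hh
      have e : indTrivialEquiv hA ((a • x) ⊗ₜ (b * c)) =
          counit (R := K) a • b * indTrivialEquiv hA (x ⊗ₜ c) := by
        rw [indTrivialEquiv_tmul, indTrivialEquiv_tmul, trivialModule_smul, smul_mul_smul_comm]
      simpa [indForm_tmul χ hx, scale_zero] using e
    · rw [mem_trivialModule_deg hA hh hx]
      simp only [TensorProduct.zero_tmul, map_zero]

/-- The morphism from the bimodule induced by the trivial module to `A`. -/
def indTrivialHom : ind (trivialModule hA) hA ⟶ envModule 𝒜 𝒜 (isGradedBimodule_self 𝒜) :=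
  GrMod.mkHom (M := ind (trivialModule hA) hA) (N := envModule 𝒜 𝒜 (isGradedBimodule_self 𝒜))
    (envLinearMap (V := (ind (trivialModule hA) hA).carrier)
      (W := (envModule 𝒜 𝒜 (isGradedBimodule_self 𝒜)).carrier)
      (indTrivialEquiv hA).toLinearMap
      (fun a v => by
        rw [ind_smul]
        refine (congrArg (indTrivialEquiv hA) (indRep_left _ hA a v)).trans ?_
        refine (indTrivialEquiv_indForm hA _ _).trans ?_
        rw [rTensor_counit_comul, TensorProduct.lid_tmul, one_smul]
        exact congrArg (a * ·) (mul_one (indTrivialEquiv hA v)).symm)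
      (fun b v => by
        rw [ind_smul]
        refine (congrArg (indTrivialEquiv hA) (indRep_right _ hA (op b) v)).trans ?_
        refine Eq.trans ?_ (one_mul (indTrivialEquiv hA v * b)).symm
        refine LinearMap.congr_fun (f := (indTrivialEquiv hA).toLinearMap ∘ₗ
          indRight (trivialModule hA) (op b))
          (g := LinearMap.mulRight K b ∘ₗ (indTrivialEquiv hA).toLinearMap)
          (TensorProduct.ext' fun x c => ?_) v
        exact (smul_mul_assoc (show K from x) c b).symm))
    (fun g v hv => by
      refine (show tensorDeg (trivialModule hA).deg 𝒜 g ≤ (𝒜 g).comap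
        (indTrivialEquiv hA).toLinearMap from tensorDeg_le fun h x hx c hc => ?_) hv
      by_cases hh : h = 0
      · subst hh
        rw [sub_zero] at hc
        exact (𝒜 g).smul_mem (show K from x) hc
      · rw [mem_trivialModule_deg hA hh hx]
        simp)

theorem isIso_indTrivialHom : IsIso (indTrivialHom hA) :=
  GrMod.isIso_of_bijective _ (indTrivialEquiv hA).bijective

variable {M : Type u} [AddCommGroup M] [Module K M] [Module A M] [Module Aᵐᵒᵖ M]
  [IsScalarTower K A M] [IsScalarTower K Aᵐᵒᵖ M] [SMulCommClass A Aᵐᵒᵖ M]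
  (ℳ : G → Submodule K M) [Decomposition ℳ] (hM : IsGradedBimodule 𝒜 ℳ)

/-- On the module over the enveloping algebra that is defined by a bimodule, the functor
`adFunctor` gives the adjoint module of the bimodule. -/
def adModuleHom : adModule ℳ hA hM ⟶ (adFunctor hA).obj (envModule 𝒜 ℳ hM) :=
  adHom hA ℳ hM (envModule 𝒜 ℳ hM).deg (envModule 𝒜 ℳ hM).isGradedBimodule_deg
    (M' := (envModule 𝒜 ℳ hM).carrier) (LinearMap.id : M →ₗ[K] M) (fun _ _ hm => hm)
    (fun a m => congrArg (a • ·) (one_smul Aᵐᵒᵖ m).symm)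
    (fun b m => (one_smul A (b • m)).symm)

theorem isIso_adModuleHom : IsIso (adModuleHom hA ℳ hM) :=
  GrMod.isIso_of_bijective _ Function.bijective_id

end Values

end

end ColorHopf

theorem theorem4 {K A G : Type u} [Field K] [AddCommGroup G] [DecidableEq G]
    [Ring A] [Algebra K A] [Coalgebra K A] (χ : Bicharacter K G) (𝒜 : G → Submodule K A)
    [GradedAlgebra 𝒜] (S : A →ₗ[K] A) (hA : IsColorHopf χ 𝒜 S)
    {M : Type u} [AddCommGroup M] [Module K M] [Module A M] [Module Aᵐᵒᵖ M]
    [IsScalarTower K A M] [IsScalarTower K Aᵐᵒᵖ M] [SMulCommClass A Aᵐᵒᵖ M]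
    (ℳ : G → Submodule K M) [Decomposition ℳ] (hM : IsGradedBimodule 𝒜 ℳ) (n : ℕ) :
    Nonempty (HHgr 𝒜 ℳ hM n ≃ₗ[K]
      Abelian.Ext.{u + 1} (trivialModule hA.toIsHopf) (adModule ℳ hA.toIsHopf hM) n) := by
  have := isIso_indTrivialHom hA.toIsHopf
  have := isIso_adModuleHom hA.toIsHopf ℳ hM
  let e := asIso (indTrivialHom hA.toIsHopf)
  let e' := asIso (adModuleHom hA.toIsHopf ℳ hM)
  exact nonempty_ext_linearEquiv K (indAdjunction hA.toIsHopf) e e' n
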